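/- **Setting.** $L^2_+(\mathbb R)$ is the space of all $f\in L^2(\mathbb R)$ whose Fourier transform is supported in $[0,\infty)$, and $C_+$ is the orthogonal projection of $L^2(\mathbb R)$ onto it. Let $q\in L^2_+(\mathbb R)$, and let $L_q=-\mathrm i\partial_x-qC_+\overline q$ in $L^2_+(\mathbb R)$ with domain $H^1_+(\mathbb R)=H^1(\mathbb R)\cap L^2_+(\mathbb R)$ and point spectrum $\sigma_{\rm p}(L_q)$. Let $$\widehat{\mathbb C}=(\mathbb C\setminus(0,\infty))\cup((0,\infty)+0\mathrm i)\cup((0,\infty)-0\mathrm i);$$ for $\lambda\le 0$, $\lambda\pm0\mathrm i$ means $\lambda$. For $E\subset\mathbb R$ put $E^\diamond=(E+0\mathrm i)\cup(E-0\mathrm i)$. For $k\in\widehat{\mathbb C}$ let $R_0(k)f=G_k*f$, where $G_k(x)=\pm\mathrm i\,\mathrm e^{\mathrm ikx}\chi_{\mathbb R_\pm}(x)$, with the upper sign if $\operatorname{Im}k>0$ or $k=\lambda+0\mathrm i$ with $\lambda>0$, and the lower sign if $\operatorname{Im}k<0$ or $k=\lambda-0\mathrm i$ with $\lambda>0$.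 For $k\in(-\infty,0]$ either sign may be used, since both give the same $R_0(k)f$ for $f\in L^1(\mathbb R)$ with $\widehat f=0$ on $(-\infty,0]$. The exceptional set $\mathcal N$ is the set of $\lambda\in[0,\infty)$ such that $\ker(1-C_+\overline qR_0(\lambda\pm0\mathrm i)qC_+)\ne\{0\}$ in $L^2(\mathbb R)$ (the set is the same for both signs). For $k\in\widehat{\mathbb C}\setminus(\sigma_{\rm p}(L_q)\cup\mathcal N)^\diamond$ let $$R(k)=R_0(k)+R_0(k)qC_+\bigl(1-C_+\overline qR_0(k)qC_+\bigr)^{-1}C_+\overline qR_0(k).$$ With $\mathrm e(\lambda)(x)=\mathrm e^{\mathrm i\lambda x}$, define for $\lambda\in[0,\infty)\setminus\mathcal N$ $$m_{\rm e}(\lambda\pm0\mathrm i)=\mathrm e(\lambda)+R(\lambda\pm0\mathrm i)\,qC_+\overline q\,\mathrm e(\lambda),\qquad \Gamma(\lambda)=1+\mathrm i\int_{\mathbb R}\mathrm e^{-\mathrm i\lambda y}\,q(y)\,\bigl(C_+\overline q\,m_{\rm e}(\lambda+0\mathrm i)\bigr)(y)\,\mathrm dy .$$ If in addition $q\in L^1(\mathbb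 R)$, define $m_0(k)=R(k)q$ for $k\in\widehat{\mathbb C}\setminus(\sigma_{\rm p}(L_q)\cup\mathcal N)^\diamond$ and, for $\lambda\in[0,\infty)\setminus\mathcal N$, $$\beta(\lambda)=\mathrm i\int_{\mathbb R}q(y)\Bigl(\bigl(C_+\overline q\,m_0(\lambda+0\mathrm i)\bigr)(y)+1\Bigr)\mathrm e^{-\mathrm i\lambda y}\,\mathrm dy .$$ **Theorem.** Let $q\in L^2_+(\mathbb R)$. Then $\mathcal N$ is bounded, $$\lim_{\lambda\to\infty}\Bigl\|m_{\rm e}(\lambda\pm0\mathrm i)-\mathrm e^{\mathrm i\lambda x}\,\mathrm e^{\mathrm i\int_{\mp\infty}^x|q(t)|^2\,\mathrm dt}\Bigr\|_{L^\infty(\mathbb R)}=0$$ for both choices of sign, and $$\lim_{\lambda\to\infty}\Bigl|\Gamma(\lambda)-\mathrm e^{\mathrm i\int_{\mathbb R}|q(t)|^2\,\mathrm dt}\Bigr|=0 .$$ If, in addition, $q\in L^1(\mathbb R)$, then every $k\in\widehat{\mathbb C}$ with $|k|$ sufficiently large lies outside $(\sigma_{\rm p}(L_q)\cup\mathcal N)^\diamond$,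 $$\lim_{|k|\to\infty}\|m_0(k)\|_{L^\infty(\mathbb R)}=0$$ uniformly in the argument of $k\in\widehat{\mathbb C}$, and $\lim_{\lambda\to\infty}\beta(\lambda)=0$. -/

import Mathlib

open MeasureTheory Filter Topology Complex
open scoped ENNReal FourierTransform

noncomputable section

namespace CalogeroMoser

/-- `L¹(ℝ)`, `L²(ℝ)` and `L^∞(ℝ)` (complex valued, Lebesgue measure). -/
abbrev L1 := Lp ℂ 1 (volume : Measure ℝ)
abbrev L2 := Lp ℂ 2 (volume : Measure ℝ)
abbrev Linf := Lp ℂ ∞ (volume : Measure ℝ)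

/-! ### The Hardy space and the Cauchy–Szegő projector -/

/-- The Hardy space `L²₊(ℝ)`: the square integrable functions whose Fourier transform is
supported in `[0, ∞)`. -/
def hardySpace : Submodule ℂ L2 where
  carrier := {f | ∀ᵐ ξ : ℝ, ξ < 0 → (𝓕 f : L2) ξ = 0}
  zero_mem' := by
    have h : (𝓕 (0 : L2) : L2) = 0 := (Lp.fourierTransformₗᵢ ℝ ℂ).map_zero
    simp only [Set.mem_ofPred_eq, h]
    filter_upwards [Lp.coeFn_zero ℂ 2 (volume : Measure ℝ)] with ξ hξ _
    rw [hξ, Pi.zero_apply]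
  add_mem' := by
    intro f g hf hg
    have h : (𝓕 (f + g) : L2) = 𝓕 f + 𝓕 g := (Lp.fourierTransformₗᵢ ℝ ℂ).map_add f g
    simp only [Set.mem_ofPred_eq, h] at hf hg ⊢
    filter_upwards [hf, hg, Lp.coeFn_add (𝓕 f : L2) (𝓕 g : L2)] with ξ h1 h2 h3 h4
    rw [h3, Pi.add_apply, h1 h4, h2 h4, add_zero]
  smul_mem' := by
    intro c f hf
    have h : (𝓕 (c • f) : L2) = c • 𝓕 f := (Lp.fourierTransformₗᵢ ℝ ℂ).map_smul c f
    simp only [Set.mem_ofPred_eq, h] at hf ⊢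
    filter_upwards [hf, Lp.coeFn_smul c (𝓕 f : L2)] with ξ h1 h3 h4
    rw [h3, Pi.smul_apply, h1 h4, smul_zero]

theorem isClosed_hardySpace : IsClosed (hardySpace : Set L2) := by
  let A : L2 →L[ℂ] Lp ℂ 2 ((volume : Measure ℝ).restrict (Set.Iio 0)) :=
    (LpToLpRestrictCLM ℝ ℂ ℂ volume 2 (Set.Iio 0)).comp
      (Lp.fourierTransformₗᵢ ℝ ℂ).toContinuousLinearEquiv.toContinuousLinearMap
  have h : (hardySpace : Set L2) = A ⁻¹' {0} := by
    ext f
    have h1 : A f =ᵐ[volume.restrict (Set.Iio 0)] (𝓕 f : L2) :=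
      LpToLpRestrictCLM_coeFn ℂ (Set.Iio 0) (𝓕 f : L2)
    have h2 : f ∈ (hardySpace : Set L2) ↔
        (𝓕 f : L2) =ᵐ[volume.restrict (Set.Iio 0)] 0 := by
      change (∀ᵐ ξ : ℝ, ξ < 0 → (𝓕 f : L2) ξ = 0) ↔ _
      rw [Filter.EventuallyEq, ae_restrict_iff' measurableSet_Iio]
      rfl
    rw [h2, Set.mem_preimage, Set.mem_singleton_iff, Lp.eq_zero_iff_ae_eq_zero]
    exact ⟨fun h => h1.trans h, fun h => h1.symm.trans h⟩
  rw [h]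
  exact isClosed_singleton.preimage A.continuous

instance : CompleteSpace hardySpace := isClosed_hardySpace.completeSpace_coe

/-- The Cauchy–Szegő projector `C₊`: the orthogonal projection of `L²(ℝ)` onto `L²₊(ℝ)`. -/
def szego : L2 →L[ℂ] L2 := hardySpace.starProjection

/-! ### Multiplication operators -/

/-- Multiplication by `a ∈ L²`, as an operator `L² → L¹`. -/
def mulL2L1 (a : L2) : L2 →L[ℂ] L1 := (ContinuousLinearMap.mul ℂ ℂ).holderL volume 2 2 1 a

/-- Multiplication by `a ∈ L²`, as an operator `L^∞ → L²`. -/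
def mulLinfL2 (a : L2) : Linf →L[ℂ] L2 := (ContinuousLinearMap.mul ℂ ℂ).holderL volume 2 ∞ 2 a

/-- The potential `q C₊ q̄`, as an operator `L^∞ → L¹`. -/
def potential (q : L2) : Linf →L[ℂ] L1 :=
  (mulL2L1 q).comp (szego.comp (mulLinfL2 (star q)))

/-! ### The slit plane with two-sided cut -/

/-- The two sides of the cut: `plus` for `+0i`, `minus` for `-0i`. -/
inductive Side
  | plus
  | minus

/-- `Ĉ = (ℂ ∖ (0,∞)) ∪ ((0,∞) + 0i) ∪ ((0,∞) - 0i)`. -/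
inductive CutPlane
  | off (k : ℂ) (hk : ¬ (0 < k.re ∧ k.im = 0))
  | edge (s : Side) (l : ℝ) (hl : 0 < l)

/-- The complex number underlying a point of `Ĉ`. -/
def CutPlane.toComplex : CutPlane → ℂ
  | .off k _ => k
  | .edge _ l _ => l

/-- The point `l ± 0i` of `Ĉ`; for `l ≤ 0` this is just `l`. -/
def boundary (s : Side) (l : ℝ) : CutPlane :=
  if hl : 0 < l then .edge s l hl else .off l (fun h => hl (by simpa using h.1))

/-- The filter `|k| → ∞` in `Ĉ` (uniformly in the argument of `k`). -/
def atInfinity : Filter CutPlane := comap (fun k => ‖k.toComplex‖) atTop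

/-- The sign with which `k` enters the free resolvent kernel: `plus` in the upper and `minus` in
the lower half plane. On `(-∞, 0]` both signs give the same operator on the integrable functions
whose Fourier transform vanishes on `(-∞, 0]`, the only ones to which the free resolvent is applied
below; `plus` is used there. -/
def CutPlane.side : CutPlane → Side
  | .off k _ => if 0 ≤ k.im then .plus else .minus
  | .edge s _ _ => s

/-! ### The free resolvent -/

/-- The kernel `± i e^{ikx} χ_{ℝ_±}(x)`. -/
def kernelAux (s : Side) (k : ℂ) (x : ℝ) : ℂ :=
  match s with
  | .plus => if 0 < x then I * exp (I * k * x) else 0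
  | .minus => if x < 0 then -I * exp (I * k * x) else 0

/-- The free resolvent kernel `G_k`, `k ∈ Ĉ`. -/
def kernel (k : CutPlane) (x : ℝ) : ℂ := kernelAux k.side k.toComplex x

theorem measurable_kernel (k : CutPlane) : Measurable (kernel k) := by
  unfold kernel kernelAux
  cases k.side
  · exact Measurable.ite measurableSet_Ioi (by fun_prop) measurable_const
  · exact Measurable.ite measurableSet_Iio (by fun_prop) measurable_const

theorem norm_kernel_le (k : CutPlane) (x : ℝ) : ‖kernel k x‖ ≤ 1 := by
  have key : ∀ z : ℂ, 0 ≤ z.im * x → ‖exp (I * z * x)‖ ≤ 1 := by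
    intro z hz
    rw [norm_exp, Real.exp_le_one_iff]
    simpa using hz
  cases k with
  | off z hz =>
    by_cases h : 0 ≤ z.im
    · simp only [kernel, CutPlane.side, CutPlane.toComplex, kernelAux, if_pos h]
      split_ifs with hx
      · simpa using key z (by positivity)
      · simp
    · simp only [kernel, CutPlane.side, CutPlane.toComplex, kernelAux, if_neg h]
      split_ifs with hx
      · simpa using key z (by nlinarith)
      · simp
  | edge s l hl =>
    cases s <;> simp only [kernel, CutPlane.side, CutPlane.toComplex, kernelAux]
    · split_ifs with hx
      · simpa using key l (by simp)
      · simp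
    · split_ifs with hx
      · simpa using key l (by simp)
      · simp

/-- The function `G_k * f`. -/
def freeConv (k : CutPlane) (f : ℝ → ℂ) (x : ℝ) : ℂ := ∫ y, kernel k (x - y) * f y

theorem integrable_kernel_mul (k : CutPlane) {f : ℝ → ℂ} (hf : Integrable f) (x : ℝ) :
    Integrable fun y => kernel k (x - y) * f y :=
  hf.bdd_mul (c := 1)
    ((measurable_kernel k).comp (measurable_const.sub measurable_id)).aestronglyMeasurable
    (Eventually.of_forall fun y => norm_kernel_le k (x - y))

theorem norm_freeConv_le (k : CutPlane) (f : L1) (x : ℝ) : ‖freeConv k f x‖ ≤ ‖f‖ := by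
  have hf : Integrable f := L1.integrable_coeFn f
  calc ‖freeConv k f x‖ ≤ ∫ y, ‖f y‖ := by
        refine norm_integral_le_of_norm_le hf.norm (Eventually.of_forall fun y => ?_)
        rw [norm_mul]
        exact mul_le_of_le_one_left (norm_nonneg _) (norm_kernel_le k _)
    _ = ‖f‖ := (L1.norm_eq_integral_norm f).symm

theorem memLp_freeConv (k : CutPlane) (f : L1) : MemLp (freeConv k f) ∞ volume := by
  refine memLp_top_of_bound ?_ ‖f‖ (Eventually.of_forall (norm_freeConv_le k f))
  refine AEStronglyMeasurable.integral_prod_right' (f := fun p : ℝ × ℝ =>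
    kernel k (p.1 - p.2) * f p.2) ?_
  refine AEStronglyMeasurable.mul ?_ ?_
  · exact ((measurable_kernel k).comp (measurable_fst.sub measurable_snd)).aestronglyMeasurable
  · exact (Lp.aestronglyMeasurable f).comp_snd

/-- The free resolvent `R₀(k)`, convolution with `G_k`, as a bounded operator `L¹ → L^∞`. -/
def freeResolvent (k : CutPlane) : L1 →L[ℂ] Linf :=
  LinearMap.mkContinuous
    { toFun := fun f => (memLp_freeConv k f).toLp _
      map_add' := by
        intro f g
        rw [← MemLp.toLp_add]
        refine MemLp.toLp_congr _ _ (Eventually.of_forall fun x => ?_)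
        simp only [freeConv, Pi.add_apply]
        rw [← integral_add (integrable_kernel_mul k (L1.integrable_coeFn f) x)
          (integrable_kernel_mul k (L1.integrable_coeFn g) x)]
        refine integral_congr_ae ?_
        filter_upwards [Lp.coeFn_add f g] with y hy
        rw [hy, Pi.add_apply, mul_add]
      map_smul' := by
        intro c f
        rw [RingHom.id_apply, ← MemLp.toLp_const_smul]
        refine MemLp.toLp_congr _ _ (Eventually.of_forall fun x => ?_)
        simp only [freeConv, Pi.smul_apply, smul_eq_mul]
        rw [← integral_const_mul]
        refine integral_congr_ae ?_
        filter_upwards [Lp.coeFn_smul c f] with y hy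
        rw [hy, Pi.smul_apply, smul_eq_mul]
        ring }
    1 (by
      intro f
      rw [one_mul]
      change ‖(memLp_freeConv k f).toLp _‖ ≤ ‖f‖
      rw [Lp.norm_toLp]
      refine ENNReal.toReal_le_of_le_ofReal (norm_nonneg f) ?_
      rw [eLpNorm_exponent_top]
      exact eLpNormEssSup_le_of_ae_bound (Eventually.of_forall (norm_freeConv_le k f)))

/-! ### The exceptional set and the perturbed resolvent -/

/-- The operator `C₊ q̄ R₀(k) q C₊` on `L²(ℝ)`. -/
def birmanSchwinger (q : L2) (k : CutPlane) : L2 →L[ℂ] L2 :=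
  szego.comp ((mulLinfL2 (star q)).comp ((freeResolvent k).comp ((mulL2L1 q).comp szego)))

/-- The sets `𝒩₊` and `𝒩₋`. -/
def exceptionalSide (q : L2) (s : Side) : Set ℝ :=
  {l | 0 ≤ l ∧ ∃ g : L2, g ≠ 0 ∧ g - birmanSchwinger q (boundary s l) g = 0}

/-- The exceptional set `𝒩`. The sets for the two signs coincide when `q ∈ L²₊`; it is written as
their union so as not to prefer a sign. -/
def exceptionalSet (q : L2) : Set ℝ := exceptionalSide q .plus ∪ exceptionalSide q .minus

/-- The perturbed resolvent, given by the resolvent identity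
`R(k) = R₀(k) + R₀(k) q C₊ (1 - C₊ q̄ R₀(k) q C₊)⁻¹ C₊ q̄ R₀(k)`.
(`Ring.inverse` is the inverse in the algebra of bounded operators on `L²(ℝ)`.) -/
def resolvent (q : L2) (k : CutPlane) : L1 →L[ℂ] Linf :=
  freeResolvent k +
    (freeResolvent k).comp ((mulL2L1 q).comp (szego.comp
      ((Ring.inverse (1 - birmanSchwinger q k)).comp
        (szego.comp ((mulLinfL2 (star q)).comp (freeResolvent k))))))

/-! ### The homogeneous Jost solutions and the scattering matrix -/

/-- The plane wave `e(λ)`, `x ↦ e^{iλx}`. -/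
def planeWave (l : ℝ) (x : ℝ) : ℂ := exp (I * l * x)

theorem memLp_planeWave (l : ℝ) : MemLp (planeWave l) ∞ volume := by
  refine memLp_top_of_bound ?_ 1 (Eventually.of_forall fun x => ?_)
  · exact Continuous.aestronglyMeasurable (by unfold planeWave; fun_prop)
  · rw [planeWave, norm_exp]
    simp

/-- The homogeneous Jost solutions `m_e(λ ± 0i) = e(λ) + R(λ ± 0i) q C₊ q̄ e(λ)`,
for `λ ∈ [0,∞) ∖ 𝒩`. -/
def jostE (q : L2) (s : Side) (l : ℝ) : Linf :=
  (memLp_planeWave l).toLp (planeWave l) +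
    resolvent q (boundary s l) (potential q ((memLp_planeWave l).toLp (planeWave l)))

/-- The scattering matrix `Γ(λ)`, for `λ ∈ [0,∞) ∖ 𝒩`. -/
def scatteringMatrix (q : L2) (l : ℝ) : ℂ :=
  1 + I * ∫ y : ℝ, exp (-I * l * y) * potential q (jostE q .plus l) y

/-- The integral `∫_{∓∞}^x |q(t)|² dt`, lower limit `-∞` for `plus` and `+∞` for `minus`. -/
def phase (q : L2) (s : Side) (x : ℝ) : ℝ :=
  match s with
  | .plus => ∫ t in Set.Iic x, ‖q t‖ ^ 2
  | .minus => -∫ t in Set.Ioi x, ‖q t‖ ^ 2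

/-! ### Eigenvalues of the Lax operator, the inhomogeneous Jost solution, and `β` -/

/-- `ψ` belongs to `H¹₊(ℝ)` with (weak) derivative `dψ`: it is in `L²₊`, and has a locally
absolutely continuous representative `u` with almost everywhere derivative `dψ ∈ L²`. -/
def InH1Plus (ψ : Linf) (dψ : L2) : Prop :=
  (∃ f ∈ hardySpace, ⇑f =ᵐ[volume] ⇑ψ) ∧
    ∃ u : ℝ → ℂ, ⇑ψ =ᵐ[volume] u ∧ ∀ a b : ℝ, u b - u a = ∫ x in a..b, dψ x

/-- The point spectrum of the operator `L_q = -i∂ₓ - q C₊ q̄` in `L²₊(ℝ)` with domain `H¹₊(ℝ)`.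
(Eigenfunctions are taken in `L^∞`, which contains `H¹₊(ℝ)`.) -/
def pointSpectrum (q : L2) : Set ℂ :=
  {z | ∃ (ψ : Linf) (dψ : L2), ψ ≠ 0 ∧ InH1Plus ψ dψ ∧
    ∀ᵐ x : ℝ, -I * dψ x - potential q ψ x = z * ψ x}

/-- The set `Ĉ ∖ (σ_p(L_q) ∪ 𝒩)^⋄` on which `m₀` is defined. -/
def regularSet (q : L2) : Set CutPlane :=
  {k | k.toComplex ∉ pointSpectrum q ∧ k.toComplex ∉ ((↑) : ℝ → ℂ) '' exceptionalSet q}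

/-- The inhomogeneous Jost solution `m₀(k) = R(k) q` for `q ∈ L²₊ ∩ L¹` and
`k ∈ Ĉ ∖ (σ_p(L_q) ∪ 𝒩)^⋄`. -/
def jostZero (q : L2) (hq : Integrable q volume) (k : CutPlane) : Linf :=
  resolvent q k (hq.toL1 q)

/-- The scattering coefficient `β(λ)`, for `λ ∈ [0,∞) ∖ 𝒩`. -/
def scatteringCoeff (q : L2) (hq : Integrable q volume) (l : ℝ) : ℂ :=
  I * ∫ y : ℝ, q y *
    (szego (mulLinfL2 (star q) (jostZero q hq (boundary .plus l))) y + 1) * exp (-I * l * y)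

end CalogeroMoser

end

/-!
High-energy asymptotics for the Lax operator `-i∂ₓ - q C₊ q̄`.

At high energy the nonlocal potential `q C₊ q̄` may be replaced by the local one `|q|²`, whose
scattering theory is explicit: `-i∂ₓ - |q|²` is conjugate to `-i∂ₓ` by the gauge factor `e^{iφ}`,
`φ' = |q|²`. Put `A = q̄ R₀(k) q` on `L²`, so that the operator to be inverted is `1 - C₊ A C₊`.

* Decoupling (`tendsto_norm_offDiag`): `(1 - C₊) b̄ R₀(k) a C₊ → 0` in operator norm as `|k| → ∞`,
  uniformly in `arg k`, for all `a, b ∈ L²`. By density `a` and `b` may be taken band-limited;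
  pairing with a negative-frequency function then involves `R₀(k)` only on a bounded set of
  frequencies `ξ`, where its symbol `1 / (2πξ - k)` is `O(1 / |k|)`.
* Gauge (`sandwich_mul_gauged`, `gauged_mul_sandwich`): with `q̃ = e^{-iφ} q` and
  `Ã = conj(q̃) R₀(k) q̃`, the operator `1 + Ã` is the two-sided inverse of `1 - A`. Both identities
  follow from the Volterra structure of the kernel of `R₀(k)` and from `(e^{iφ})' = i |q|² e^{iφ}`.
* Hence `1 + C₊ Ã C₊` inverts `1 - C₊ A C₊` up to decoupling terms, and for large `|k|` the
  latter is invertible with a uniformly bounded inverse (`eventually_isUnit`). This bounds the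
  exceptional set, and it excludes large eigenvalues, because an eigenfunction satisfies
  `ψ = R₀(k) q C₊ q̄ ψ` (`notMem_pointSpectrum`).
* The gauged plane wave `M = e^{iλx} e^{iφ}` solves `M = e(λ) + R₀ |q|² M`, so `h = q̄ M` solves the
  equation defining `C₊ q̄ m_e` up to the part of `h` of negative frequency. That part tends to `0`,
  since `h` is a fixed `L²` function modulated by `e(λ)`. Therefore `C₊ q̄ m_e - h → 0` in `L²`
  (`tendsto_amplitude_sub_gaugedAmplitude`), which yields the limits of `m_e` and `Γ`.
* For `q ∈ L¹` the limits of `m₀` and `β` follow from the uniform bound on the inverse and the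
  Riemann–Lebesgue lemma for `R₀(k)` (`tendsto_norm_freeResolvent`).
-/

noncomputable section

namespace CalogeroMoser

/-! ### Multiplication, translation and spectral support on `L²` -/

theorem coeFn_star_ae (a : L2) : ⇑(star a) =ᵐ[volume] fun x => star (a x) := Lp.coeFn_star a

theorem norm_star_L2 (a : L2) : ‖star a‖ = ‖a‖ := by
  rw [Lp.norm_def, Lp.norm_def]
  congr 1
  refine eLpNorm_congr_norm_ae ?_
  filter_upwards [coeFn_star_ae a] with x hx
  rw [hx, norm_star]

theorem star_sub_L2 (a b : L2) : star (a - b) = star a - star b := by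
  apply Lp.ext
  filter_upwards [coeFn_star_ae (a - b), Lp.coeFn_sub (star a) (star b), coeFn_star_ae a,
    coeFn_star_ae b, Lp.coeFn_sub a b] with x h1 h2 h3 h4 h5
  rw [h1, h2, Pi.sub_apply, h3, h4, h5, Pi.sub_apply, star_sub]

theorem coeFn_mulL2L1 (a g : L2) : mulL2L1 a g =ᵐ[volume] fun x => a x * g x :=
  (ContinuousLinearMap.mul ℂ ℂ).coeFn_holder a g

theorem coeFn_mulLinfL2 (a : L2) (g : Linf) : mulLinfL2 a g =ᵐ[volume] fun x => a x * g x :=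
  (ContinuousLinearMap.mul ℂ ℂ).coeFn_holder a g

theorem norm_mulL2L1_apply_le (a g : L2) : ‖mulL2L1 a g‖ ≤ ‖a‖ * ‖g‖ := by
  have h := (ContinuousLinearMap.mul ℂ ℂ).norm_holder_apply_apply_le (μ := volume) (r := 1) a g
  rwa [ContinuousLinearMap.opNorm_mul, one_mul] at h

theorem norm_mulLinfL2_apply_le (a : L2) (g : Linf) : ‖mulLinfL2 a g‖ ≤ ‖a‖ * ‖g‖ := by
  have h := (ContinuousLinearMap.mul ℂ ℂ).norm_holder_apply_apply_le (μ := volume) (r := 2) a g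
  rwa [ContinuousLinearMap.opNorm_mul, one_mul] at h

/-- Multiplication by `u ∈ L^∞`, as an operator `L² → L²`. -/
def mulLinf (u : Linf) : L2 →L[ℂ] L2 := (ContinuousLinearMap.mul ℂ ℂ).holderL volume ∞ 2 2 u

theorem coeFn_mulLinf (u : Linf) (g : L2) : mulLinf u g =ᵐ[volume] fun x => u x * g x :=
  (ContinuousLinearMap.mul ℂ ℂ).coeFn_holder u g

/-- The plane wave `e(λ)` as an element of `L^∞`. -/
def planeWaveLp (l : ℝ) : Linf := (memLp_planeWave l).toLp (planeWave l)

theorem coeFn_planeWaveLp (l : ℝ) : planeWaveLp l =ᵐ[volume] planeWave l :=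
  MemLp.coeFn_toLp _

/-- Multiplication by the plane wave `e(λ)` on `L²`. -/
def modulate (l : ℝ) : L2 →L[ℂ] L2 := mulLinf (planeWaveLp l)

theorem coeFn_modulate (l : ℝ) (g : L2) :
    modulate l g =ᵐ[volume] fun x => planeWave l x * g x := by
  filter_upwards [coeFn_mulLinf (planeWaveLp l) g, coeFn_planeWaveLp l] with x h1 h2
  rw [modulate, h1, h2]

/-- Translation `f ↦ f (· - t)` on `L²`. -/
def translate (t : ℝ) : L2 →+ L2 :=
  Lp.compMeasurePreserving (fun x => x - t) (measurePreserving_sub_right volume t)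

theorem coeFn_translate (t : ℝ) (f : L2) : translate t f =ᵐ[volume] fun x => f (x - t) :=
  Lp.coeFn_compMeasurePreserving f (measurePreserving_sub_right volume t)

theorem continuous_translate (t : ℝ) : Continuous (translate t) :=
  (Lp.isometry_compMeasurePreserving (measurePreserving_sub_right volume t)).continuous

theorem norm_planeWave (l x : ℝ) : ‖planeWave l x‖ = 1 := by
  rw [planeWave, norm_exp]; simp

theorem contDiff_planeWave (l : ℝ) : ContDiff ℝ (⊤ : ℕ∞) (planeWave l) := by
  unfold planeWave
  have h : ContDiff ℝ (⊤ : ℕ∞) (fun x : ℝ => (x : ℂ)) := ofRealCLM.contDiff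
  exact (contDiff_const.mul h).cexp

/-- A relation between continuous maps on `L²` holds once it holds on test functions. -/
theorem eq_of_eq_on_testFunctions {A B : L2 → L2} (hA : Continuous A) (hB : Continuous B)
    (h : ∀ φ : SchwartzMap ℝ ℂ, HasCompactSupport φ → A (φ.toLp 2) = B (φ.toLp 2)) (f : L2) :
    A f = B f := by
  refine (isClosed_eq hA hB).closure_subset_iff.2 ?_
    ((Lp.dense_hasCompactSupport_contDiff (F := ℂ) (μ := (volume : Measure ℝ)) (p := 2)
      (by norm_num)) f)
  rintro u ⟨g, hug, hg1, hg2⟩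
  have : u = (hg1.toSchwartzMap hg2).toLp 2 := by
    apply Lp.ext
    filter_upwards [hug, (hg1.toSchwartzMap hg2).coeFn_toLp 2 volume] with x h1 h2
    rw [h1, h2]; rfl
  rw [Set.mem_ofPred_eq, this]
  exact h _ hg1

theorem fourier_modulate (l : ℝ) (f : L2) :
    (𝓕 (modulate l f) : L2) = translate (l / (2 * Real.pi)) (𝓕 f : L2) := by
  refine eq_of_eq_on_testFunctions (A := fun f => (𝓕 (modulate l f) : L2))
    (B := fun f => translate (l / (2 * Real.pi)) (𝓕 f : L2)) ?_ ?_ ?_ f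
  · exact (Lp.fourierTransformₗᵢ ℝ ℂ).continuous.comp (modulate l).continuous
  · exact (continuous_translate _).comp (Lp.fourierTransformₗᵢ ℝ ℂ).continuous
  · intro φ hφ
    have h1 : HasCompactSupport (fun x => planeWave l x * φ x) := hφ.mul_left
    have h2 : ContDiff ℝ (⊤ : ℕ∞) (fun x => planeWave l x * φ x) :=
      (contDiff_planeWave l).mul (φ.smooth _)
    have hto : ∀ x, h1.toSchwartzMap h2 x = planeWave l x * φ x := fun _ => rfl
    have h3 : modulate l (φ.toLp 2) = (h1.toSchwartzMap h2).toLp 2 := by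
      apply Lp.ext
      filter_upwards [coeFn_modulate l (φ.toLp 2), φ.coeFn_toLp 2 volume,
        (h1.toSchwartzMap h2).coeFn_toLp 2 volume] with x e1 e2 e3
      rw [e1, e2, e3]; rfl
    rw [h3, SchwartzMap.toLp_fourier_eq, SchwartzMap.toLp_fourier_eq]
    apply Lp.ext
    have hmp := measurePreserving_sub_right (volume : Measure ℝ) (l / (2 * Real.pi))
    filter_upwards [coeFn_translate (l / (2 * Real.pi)) ((𝓕 φ).toLp 2),
      (𝓕 (h1.toSchwartzMap h2)).coeFn_toLp 2 volume,
      hmp.quasiMeasurePreserving.ae ((𝓕 φ).coeFn_toLp 2 volume)] with ξ e1 e2 e3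
    rw [e1, e2, e3, SchwartzMap.fourier_coe, SchwartzMap.fourier_coe,
      Real.fourier_real_eq_integral_exp_smul, Real.fourier_real_eq_integral_exp_smul]
    refine integral_congr_ae (Eventually.of_forall fun x => ?_)
    simp only [smul_eq_mul]
    rw [hto, planeWave, ← mul_assoc, ← exp_add]
    congr 2
    push_cast
    field_simp
    ring

theorem fourier_translate (t : ℝ) (f : L2) :
    (𝓕 (translate t f) : L2) = modulate (-(2 * Real.pi * t)) (𝓕 f : L2) := by
  refine eq_of_eq_on_testFunctions (A := fun f => (𝓕 (translate t f) : L2))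
    (B := fun f => modulate (-(2 * Real.pi * t)) (𝓕 f : L2)) ?_ ?_ ?_ f
  · exact (Lp.fourierTransformₗᵢ ℝ ℂ).continuous.comp (continuous_translate t)
  · exact (modulate _).continuous.comp (Lp.fourierTransformₗᵢ ℝ ℂ).continuous
  · intro φ hφ
    have h1 : HasCompactSupport (fun x => φ (x - t)) :=
      hφ.comp_homeomorph (Homeomorph.subRight t)
    have h2 : ContDiff ℝ (⊤ : ℕ∞) (fun x => φ (x - t)) :=
      (φ.smooth _).comp (contDiff_id.sub contDiff_const)
    have hto : ∀ x, h1.toSchwartzMap h2 x = φ (x - t) := fun _ => rfl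
    have hmp := measurePreserving_sub_right (volume : Measure ℝ) t
    have h3 : translate t (φ.toLp 2) = (h1.toSchwartzMap h2).toLp 2 := by
      apply Lp.ext
      filter_upwards [coeFn_translate t (φ.toLp 2), (h1.toSchwartzMap h2).coeFn_toLp 2 volume,
        hmp.quasiMeasurePreserving.ae (φ.coeFn_toLp 2 volume)] with x e1 e2 e3
      rw [e1, e2, e3]; rfl
    rw [h3, SchwartzMap.toLp_fourier_eq, SchwartzMap.toLp_fourier_eq]
    apply Lp.ext
    filter_upwards [coeFn_modulate (-(2 * Real.pi * t)) ((𝓕 φ).toLp 2),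
      (𝓕 (h1.toSchwartzMap h2)).coeFn_toLp 2 volume,
      (𝓕 φ).coeFn_toLp 2 volume] with ξ e1 e2 e3
    rw [e1, e2, e3, SchwartzMap.fourier_coe, SchwartzMap.fourier_coe,
      Real.fourier_real_eq_integral_exp_smul, Real.fourier_real_eq_integral_exp_smul,
      ← integral_const_mul]
    refine Eq.trans ?_ (integral_sub_right_eq_self _ t)
    refine integral_congr_ae (Eventually.of_forall fun x => ?_)
    simp only [hto, smul_eq_mul, planeWave]
    rw [← mul_assoc, ← exp_add]
    congr 2
    push_cast
    ring

/-- `f ∈ L²` has its Fourier transform supported in `S`. -/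
def SpectrumIn (S : Set ℝ) (f : L2) : Prop := ∀ᵐ ξ : ℝ, ξ ∉ S → (𝓕 f : L2) ξ = 0

theorem mem_hardySpace_iff {f : L2} : f ∈ hardySpace ↔ SpectrumIn (Set.Ici 0) f := by
  simp only [SpectrumIn, Set.mem_Ici, not_le]
  rfl

theorem inner_eq_zero_of_spectrumIn {S S' : Set ℝ} (hS : Disjoint S S') {f g : L2}
    (hf : SpectrumIn S f) (hg : SpectrumIn S' g) : inner ℂ f g = 0 := by
  rw [← Lp.inner_fourier_eq, L2.inner_def]
  refine integral_eq_zero_of_ae ?_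
  filter_upwards [hf, hg] with ξ h1 h2
  by_cases h : ξ ∈ S
  · rw [h2 (Set.disjoint_left.1 hS h)]; simp
  · rw [h1 h]; simp

/-- Spectral support is detected by orthogonality to the complementary spectral subspace. -/
theorem spectrumIn_of_inner_eq_zero {S : Set ℝ} (hS : MeasurableSet S) {f : L2}
    (h : ∀ g : L2, SpectrumIn Sᶜ g → inner ℂ g f = 0) : SpectrumIn S f := by
  -- Test against the spectral projection `u` of `f` onto `Sᶜ`, so that `⟪u, f⟫ = ‖u‖²`.
  have hm : MemLp (Sᶜ.indicator (𝓕 f : L2)) 2 volume := (Lp.memLp _).indicator hS.compl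
  set u : L2 := hm.toLp _ with hu
  have hue : u =ᵐ[volume] Sᶜ.indicator (𝓕 f : L2) := hm.coeFn_toLp
  have hFu : (𝓕 (𝓕⁻ u : L2) : L2) = u := FourierTransform.fourier_fourierInv_eq u
  have h1 : SpectrumIn Sᶜ (𝓕⁻ u : L2) := by
    unfold SpectrumIn
    rw [hFu]
    filter_upwards [hue] with ξ h1 h2
    rw [h1, Set.indicator_of_notMem h2]
  have h2 := h _ h1
  rw [← Lp.inner_fourier_eq, hFu] at h2
  have h3 : inner ℂ u (𝓕 f : L2) = inner ℂ u u := by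
    rw [L2.inner_def, L2.inner_def]
    refine integral_congr_ae ?_
    filter_upwards [hue] with ξ e
    by_cases hξ : ξ ∈ Sᶜ
    · rw [e, Set.indicator_of_mem hξ]
    · rw [e, Set.indicator_of_notMem hξ]; simp
  rw [h3, inner_self_eq_zero] at h2
  rw [h2] at hue
  filter_upwards [hue, Lp.coeFn_zero ℂ 2 (volume : Measure ℝ)] with ξ e e0 hξ
  rw [e0, Pi.zero_apply, Set.indicator_of_mem (by exact hξ)] at e
  exact e.symm

theorem SpectrumIn.modulate {S S' : Set ℝ} {l : ℝ} {f : L2} (hf : SpectrumIn S f)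
    (h : ∀ ξ ∈ S, ξ + l / (2 * Real.pi) ∈ S') : SpectrumIn S' (modulate l f) := by
  unfold SpectrumIn
  rw [fourier_modulate]
  have hmp := measurePreserving_sub_right (volume : Measure ℝ) (l / (2 * Real.pi))
  filter_upwards [coeFn_translate (l / (2 * Real.pi)) (𝓕 f : L2),
    hmp.quasiMeasurePreserving.ae hf] with ξ e1 e2 hξ
  rw [e1]
  refine e2 fun h3 => hξ ?_
  simpa using h _ h3

/-! ### Half-line kernels tested against band-limited functions -/

/-- `k` lies in the closed half plane on which the kernel with sign `s` is bounded. -/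
def Side.Admits (s : Side) (k : ℂ) : Prop :=
  match s with
  | .plus => 0 ≤ k.im
  | .minus => k.im ≤ 0

theorem CutPlane.side_admits (k : CutPlane) : k.side.Admits k.toComplex := by
  cases k with
  | off z hz =>
    by_cases h : 0 ≤ z.im
    · simp [CutPlane.side, CutPlane.toComplex, h, Side.Admits]
    · simpa [CutPlane.side, CutPlane.toComplex, h, Side.Admits] using (not_le.1 h).le
  | edge s l hl => cases s <;> simp [CutPlane.side, CutPlane.toComplex, Side.Admits]

theorem kernelAux_minus (k : ℂ) (x : ℝ) : kernelAux .minus k x = -kernelAux .plus (-k) (-x) := by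
  simp only [kernelAux, Left.neg_pos_iff]
  split_ifs <;> simp

theorem measurable_kernelAux (s : Side) (k : ℂ) : Measurable (kernelAux s k) := by
  unfold kernelAux
  cases s
  · exact Measurable.ite measurableSet_Ioi (by fun_prop) measurable_const
  · exact Measurable.ite measurableSet_Iio (by fun_prop) measurable_const

theorem norm_kernelAux_plus_le {k : ℂ} (hk : 0 ≤ k.im) (x : ℝ) : ‖kernelAux .plus k x‖ ≤ 1 := by
  simp only [kernelAux]
  split_ifs with hx
  · rw [norm_mul, norm_I, one_mul, norm_exp, Real.exp_le_one_iff]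
    simp only [mul_re, I_re, zero_mul, I_im, one_mul, zero_sub, ofReal_re, mul_im, zero_add,
      ofReal_im, mul_zero, sub_zero]
    nlinarith
  · simp

theorem continuous_planeWave (l : ℝ) : Continuous (planeWave l) := (contDiff_planeWave l).continuous

/-- On the Fourier side the kernel is the multiplier `-1 / (k - 2πξ)`. -/
theorem integral_kernelAux_mul_fourier {k : ℂ} (hk : 0 < k.im) {ψ : ℝ → ℂ} (hψ : Integrable ψ) :
    ∫ t : ℝ, kernelAux .plus k t * ∫ ξ : ℝ, planeWave (-(2 * Real.pi * t)) ξ * ψ ξ =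
      ∫ ξ : ℝ, -(ψ ξ / (k - 2 * Real.pi * ξ)) := by
  have h0 : ∀ g : ℝ → ℂ, ∫ t : ℝ, kernelAux .plus k t * g t =
      ∫ t in Set.Ioi (0 : ℝ), I * exp (I * k * t) * g t := by
    intro g
    rw [← integral_indicator measurableSet_Ioi]
    refine integral_congr_ae (Eventually.of_forall fun t => ?_)
    by_cases ht : 0 < t <;> simp [kernelAux, ht]
  have hre : (I * k).re < 0 := by simpa using hk
  have hint : Integrable (fun t : ℝ => exp (I * k * t)) (volume.restrict (Set.Ioi 0)) :=
    integrableOn_exp_mul_complex_Ioi hre 0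
  rw [h0]
  have h1 : ∀ t : ℝ, I * exp (I * k * t) * ∫ ξ : ℝ, planeWave (-(2 * Real.pi * t)) ξ * ψ ξ =
      ∫ ξ : ℝ, I * exp (I * k * t) * (planeWave (-(2 * Real.pi * t)) ξ * ψ ξ) := fun t =>
    (integral_const_mul _ _).symm
  simp_rw [h1]
  rw [integral_integral_swap]
  · refine integral_congr_ae (Eventually.of_forall fun ξ => ?_)
    have h2 : ∀ t : ℝ, I * exp (I * k * t) * (planeWave (-(2 * Real.pi * t)) ξ * ψ ξ) =
        I * ψ ξ * exp ((I * (k - 2 * Real.pi * ξ)) * t) := by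
      intro t
      have : exp ((I * (k - 2 * Real.pi * ξ)) * t) =
          exp (I * k * t) * planeWave (-(2 * Real.pi * t)) ξ := by
        rw [planeWave, ← exp_add]
        congr 1
        push_cast
        ring
      rw [this]; ring
    have hre' : (I * (k - 2 * Real.pi * ξ)).re < 0 := by simpa using hk
    have hne : k - 2 * Real.pi * ξ ≠ 0 := by
      intro h
      rw [h] at hre'
      simp at hre'
    simp only [h2]
    rw [integral_const_mul, integral_exp_mul_complex_Ioi hre' 0]
    simp only [ofReal_zero, mul_zero, exp_zero]
    field_simp
  · have h3 : Integrable (fun p : ℝ × ℝ => exp (I * k * p.1) * ψ p.2)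
        ((volume.restrict (Set.Ioi 0)).prod volume) := hint.mul_prod hψ
    have h4 : (Function.uncurry fun (t ξ : ℝ) =>
        I * exp (I * k * t) * (planeWave (-(2 * Real.pi * t)) ξ * ψ ξ)) = fun p : ℝ × ℝ =>
        (I * planeWave (-(2 * Real.pi * p.1)) p.2) * (exp (I * k * p.1) * ψ p.2) := by
      ext p; simp only [Function.uncurry]; ring
    rw [h4]
    refine h3.bdd_mul (c := 1) ?_ (Eventually.of_forall fun p => ?_)
    · refine Continuous.aestronglyMeasurable ?_
      unfold planeWave; fun_prop
    · rw [norm_mul, norm_I, norm_planeWave, one_mul]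

/-- The half-line transform of a band-limited function `c` is of size `1 / |k|`. Real `k` are
reached as limits from inside the half plane. -/
theorem norm_integral_kernelAux_plus_le {k : ℂ} (hk : 0 ≤ k.im) {ψ : ℝ → ℂ} (hψ : Integrable ψ)
    {M : ℝ} (hM : ∀ᵐ ξ : ℝ, M < |ξ| → ψ ξ = 0) (hkM : 2 * Real.pi * M < ‖k‖) {c : ℝ → ℂ}
    (hc : ∀ t, c t = ∫ ξ : ℝ, planeWave (-(2 * Real.pi * t)) ξ * ψ ξ) (hci : Integrable c) :
    ‖∫ t : ℝ, kernelAux .plus k t * c t‖ ≤ (∫ ξ, ‖ψ ξ‖) / (‖k‖ - 2 * Real.pi * M) := by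
  have strict : ∀ z : ℂ, 0 < z.im → 2 * Real.pi * M < ‖z‖ →
      ‖∫ t : ℝ, kernelAux .plus z t * c t‖ ≤ (∫ ξ, ‖ψ ξ‖) / (‖z‖ - 2 * Real.pi * M) := by
    intro z hz hzM
    simp_rw [hc]
    rw [integral_kernelAux_mul_fourier hz hψ, ← integral_div]
    refine norm_integral_le_of_norm_le (hψ.norm.div_const _) ?_
    filter_upwards [hM] with ξ hξ
    rw [norm_neg, norm_div]
    by_cases h : M < |ξ|
    · simp [hξ h]
    · refine div_le_div_of_nonneg_left (norm_nonneg _) (by linarith) ?_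
      have h1 : ‖(2 * Real.pi * ξ : ℂ)‖ ≤ 2 * Real.pi * M := by
        simp only [norm_mul, norm_ofNat, norm_real, Real.norm_eq_abs, abs_of_pos Real.pi_pos]
        have := Real.pi_pos
        nlinarith
      linarith [norm_sub_norm_le z (2 * Real.pi * ξ)]
  have hz : Tendsto (fun n : ℕ => k + ((1 / ((n : ℝ) + 1) : ℝ) : ℂ) * I) atTop (𝓝 k) := by
    have h : Tendsto (fun n : ℕ => ((1 / ((n : ℝ) + 1) : ℝ) : ℂ)) atTop (𝓝 ((0 : ℝ) : ℂ)) :=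
      (continuous_ofReal.tendsto 0).comp tendsto_one_div_add_atTop_nhds_zero_nat
    simpa using tendsto_const_nhds.add (h.mul_const I)
  have him : ∀ n : ℕ, 0 < (k + ((1 / ((n : ℝ) + 1) : ℝ) : ℂ) * I).im := by
    intro n
    have : (0 : ℝ) < 1 / ((n : ℝ) + 1) := by positivity
    simp only [add_im, mul_im, ofReal_re, I_im, mul_one, ofReal_im, I_re, mul_zero, add_zero]
    linarith
  have hl : Tendsto (fun n : ℕ => ∫ t : ℝ,
      kernelAux .plus (k + ((1 / ((n : ℝ) + 1) : ℝ) : ℂ) * I) t * c t) atTop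
      (𝓝 (∫ t : ℝ, kernelAux .plus k t * c t)) := by
    refine tendsto_integral_of_dominated_convergence (fun t => ‖c t‖) (fun n => ?_) hci.norm
      (fun n => Eventually.of_forall fun t => ?_) (Eventually.of_forall fun t => ?_)
    · exact (measurable_kernelAux _ _).aestronglyMeasurable.mul hci.aestronglyMeasurable
    · rw [norm_mul]
      exact mul_le_of_le_one_left (norm_nonneg _) (norm_kernelAux_plus_le (him n).le t)
    · refine Tendsto.mul_const _ ?_
      simp only [kernelAux]
      split_ifs
      · have : Continuous fun z : ℂ => I * exp (I * z * t) := by fun_prop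
        exact (this.tendsto k).comp hz
      · exact tendsto_const_nhds
  have hd : ‖k‖ - 2 * Real.pi * M ≠ 0 := by linarith
  refine le_of_tendsto_of_tendsto hl.norm
    ((tendsto_const_nhds (x := ∫ ξ, ‖ψ ξ‖)).div (hz.norm.sub_const (2 * Real.pi * M)) hd) ?_
  filter_upwards [hz.norm.eventually_const_lt hkM] with n hn
  exact strict _ (him n) hn

theorem norm_integral_kernel_le (k : CutPlane) {ψ : ℝ → ℂ} (hψ : Integrable ψ)
    {M : ℝ} (hM : ∀ᵐ ξ : ℝ, M < |ξ| → ψ ξ = 0) (hkM : 2 * Real.pi * M < ‖k.toComplex‖)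
    {c : ℝ → ℂ} (hc : ∀ t, c t = ∫ ξ : ℝ, planeWave (-(2 * Real.pi * t)) ξ * ψ ξ)
    (hci : Integrable c) :
    ‖∫ t : ℝ, kernel k t * c t‖ ≤ (∫ ξ, ‖ψ ξ‖) / (‖k.toComplex‖ - 2 * Real.pi * M) := by
  have hk := k.side_admits
  unfold kernel
  cases hs : k.side with
  | plus =>
    rw [hs] at hk
    exact norm_integral_kernelAux_plus_le hk hψ hM hkM hc hci
  | minus =>
    rw [hs] at hk
    have hk' : 0 ≤ (-k.toComplex).im := by
      rw [neg_im, neg_nonneg]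
      exact hk
    have hmp := Measure.measurePreserving_neg (volume : Measure ℝ)
    have h := norm_integral_kernelAux_plus_le hk' (ψ := fun ξ => ψ (-ξ)) (M := M)
      (c := fun t => c (-t)) hψ.comp_neg ?_ (by rwa [norm_neg]) ?_ hci.comp_neg
    · rw [norm_neg, integral_neg_eq_self (fun ξ => ‖ψ ξ‖)] at h
      rw [← integral_neg_eq_self]
      simp only [kernelAux_minus, neg_neg, neg_mul, integral_neg, norm_neg]
      exact h
    · filter_upwards [hmp.quasiMeasurePreserving.ae hM] with ξ hξ hM'
      exact hξ (by rwa [abs_neg])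
    · intro t
      rw [hc, ← integral_neg_eq_self]
      refine integral_congr_ae (Eventually.of_forall fun ξ => ?_)
      simp only [planeWave]
      push_cast
      ring_nf

/-- The pairing of `G_k * f` with `g`, as an integral of `G_k` against the correlation of `f`
and `g`. -/
theorem integral_mul_freeConv (k : CutPlane) {f g : ℝ → ℂ} (hf : Integrable f)
    (hg : Integrable g) :
    Integrable (fun t => ∫ x, g x * f (x - t)) ∧
      ∫ x, g x * freeConv k f x = ∫ t, kernel k t * ∫ x, g x * f (x - t) := by
  have h1 : Integrable (fun p : ℝ × ℝ => g p.1 * f (p.1 - p.2)) (volume.prod volume) := by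
    have h2 : Integrable (fun p : ℝ × ℝ => g p.1 * f p.2) (volume.prod volume) := hg.mul_prod hf
    have h3 : MeasurePreserving (fun p : ℝ × ℝ => (p.1, p.1 - p.2)) (volume.prod volume)
        (volume.prod volume) := by
      refine MeasurePreserving.skew_product (g := fun x t => x - t) (MeasurePreserving.id _)
        (by fun_prop) (Eventually.of_forall fun x => ?_)
      exact (Measure.measurePreserving_sub_left volume x).map_eq
    exact h3.integrable_comp_of_integrable h2
  refine ⟨h1.integral_prod_right, ?_⟩
  have h4 : ∀ x, g x * freeConv k f x = ∫ t, kernel k t * (g x * f (x - t)) := by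
    intro x
    rw [freeConv, ← integral_const_mul, ← integral_sub_left_eq_self _ volume x]
    refine integral_congr_ae (Eventually.of_forall fun t => ?_)
    simp only [sub_sub_cancel]
    ring
  simp_rw [h4]
  rw [integral_integral_swap]
  · simp_rw [integral_const_mul]
  · refine h1.bdd_mul (c := 1) ((measurable_kernel k).comp measurable_snd).aestronglyMeasurable
      (Eventually.of_forall fun p => norm_kernel_le k _)

/-! ### Decoupling of positive and negative frequencies at high energy -/

/-- `a` is a superposition of plane waves `e(2πs)`, `|s| ≤ M`, with integrable amplitude. -/
def BandLimited (M : ℝ) (a : L2) : Prop :=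
  ∃ α : ℝ → ℂ, Integrable α ∧ (∀ s, M < |s| → α s = 0) ∧
    a =ᵐ[volume] fun x => ∫ s, α s * planeWave (2 * Real.pi * s) x

/-- Band-limited functions with bounded spectrum are dense in `L²`. -/
theorem exists_bandLimited_near (a : L2) {ε : ℝ} (hε : 0 < ε) :
    ∃ (M : ℝ) (b : L2), ‖a - b‖ < ε ∧ BandLimited M b ∧ SpectrumIn (Set.Icc (-M) M) b := by
  obtain ⟨u, ⟨g, hug, hg1, hg2⟩, hdist⟩ :=
    (Lp.dense_hasCompactSupport_contDiff (F := ℂ) (μ := (volume : Measure ℝ)) (p := 2)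
      (by norm_num)).exists_dist_lt (𝓕 a : L2) hε
  set φ : SchwartzMap ℝ ℂ := hg1.toSchwartzMap hg2
  have hu : u = φ.toLp 2 := by
    apply Lp.ext
    filter_upwards [hug, φ.coeFn_toLp 2 volume] with x h1 h2
    rw [h1, h2]; rfl
  obtain ⟨M, hM⟩ := hg1.isCompact.isBounded.exists_norm_le
  have hM' : ∀ s, M < |s| → φ s = 0 := by
    intro s hs
    have : s ∉ tsupport g := fun h => by
      have := hM s h
      rw [Real.norm_eq_abs] at this
      exact absurd hs (not_lt.2 this)
    exact image_eq_zero_of_notMem_tsupport this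
  refine ⟨M, (𝓕⁻ u : L2), ?_, ⟨φ, φ.integrable, hM', ?_⟩, ?_⟩
  · have h := (Lp.fourierTransformₗᵢ ℝ ℂ).norm_map (a - (𝓕⁻ u : L2))
    have h2 : (Lp.fourierTransformₗᵢ ℝ ℂ) (𝓕⁻ u : L2) = u :=
      (Lp.fourierTransformₗᵢ ℝ ℂ).apply_symm_apply u
    rw [map_sub, h2] at h
    rw [← h, ← dist_eq_norm]
    exact hdist
  · rw [hu, SchwartzMap.toLp_fourierInv_eq]
    filter_upwards [(𝓕⁻ φ).coeFn_toLp 2 volume] with x hx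
    rw [hx, SchwartzMap.fourierInv_coe, Real.fourierInv_eq']
    refine integral_congr_ae (Eventually.of_forall fun s => ?_)
    simp only [smul_eq_mul, planeWave, RCLike.inner_apply, conj_trivial]
    rw [mul_comm]
    congr 2
    push_cast
    ring
  · unfold SpectrumIn
    rw [show (𝓕 (𝓕⁻ u : L2) : L2) = u from FourierTransform.fourier_fourierInv_eq u, hu]
    filter_upwards [φ.coeFn_toLp 2 volume] with ξ h1 h2
    rw [h1]
    refine hM' _ ?_
    by_contra h
    exact h2 (abs_le.1 (not_lt.1 h))

theorem BandLimited.ae_bound {M : ℝ} {a : L2} (ha : BandLimited M a) :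
    ∃ C : ℝ, 0 ≤ C ∧ ∀ᵐ x, ‖a x‖ ≤ C := by
  obtain ⟨α, h1, -, h2⟩ := ha
  refine ⟨∫ s, ‖α s‖, integral_nonneg fun s => norm_nonneg _, ?_⟩
  filter_upwards [h2] with x hx
  rw [hx]
  refine norm_integral_le_of_norm_le h1.norm (Eventually.of_forall fun s => ?_)
  rw [norm_mul, norm_planeWave, mul_one]

/-- Multiplication by a function with frequencies in `[-M, M]` moves spectra by at most `M`. -/
theorem BandLimited.spectrumIn_mul {M : ℝ} {a : L2} (ha : BandLimited M a) {S S' : Set ℝ}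
    (hS' : MeasurableSet S') (hSS' : ∀ s, |s| ≤ M → ∀ ξ ∈ S, ξ + s ∈ S') {f h : L2}
    (hf : SpectrumIn S f) (hh : h =ᵐ[volume] fun x => a x * f x) : SpectrumIn S' h := by
  obtain ⟨α, h1, h2, h3⟩ := ha
  -- Pair with `g` and exchange integrals: each plane wave of `a` contributes `0`.
  refine spectrumIn_of_inner_eq_zero hS' fun g hg => ?_
  have hgf : Integrable (fun x => inner ℂ (g x) (f x)) := L2.integrable_inner g f
  have e1 : inner ℂ g h = ∫ x, ∫ s, α s * (planeWave (2 * Real.pi * s) x *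
      inner ℂ (g x) (f x)) := by
    rw [L2.inner_def]
    refine integral_congr_ae ?_
    filter_upwards [hh, h3] with x hx1 hx2
    rw [hx1, hx2, ← smul_eq_mul, inner_smul_right, ← integral_mul_const]
    simp only [mul_assoc]
  rw [e1, integral_integral_swap]
  · refine integral_eq_zero_of_ae (Eventually.of_forall fun s => ?_)
    change ∫ x, α s * (planeWave (2 * Real.pi * s) x * inner ℂ (g x) (f x)) = 0
    by_cases hs : M < |s|
    · simp [h2 s hs]
    · rw [integral_const_mul]
      have h4 : SpectrumIn S' (CalogeroMoser.modulate (2 * Real.pi * s) f) := by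
        refine hf.modulate fun ξ hξ => ?_
        have : 2 * Real.pi * s / (2 * Real.pi) = s := by
          have := Real.pi_pos
          field_simp
        rw [this]
        exact hSS' s (not_lt.1 hs) ξ hξ
      have h5 := inner_eq_zero_of_spectrumIn disjoint_compl_left hg h4
      rw [L2.inner_def] at h5
      rw [mul_eq_zero]
      right
      rw [← h5]
      refine (integral_congr_ae ?_)
      filter_upwards [coeFn_modulate (2 * Real.pi * s) f] with x hx
      simp only [hx, RCLike.inner_apply]
      ring
  · have h6 : Integrable (fun p : ℝ × ℝ => inner ℂ (g p.1) (f p.1) * α p.2)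
        (volume.prod volume) := hgf.mul_prod h1
    have h7 : (Function.uncurry fun (x s : ℝ) => α s * (planeWave (2 * Real.pi * s) x *
        inner ℂ (g x) (f x))) = fun p : ℝ × ℝ => planeWave (2 * Real.pi * p.2) p.1 *
          (inner ℂ (g p.1) (f p.1) * α p.2) := by
      ext p; simp only [Function.uncurry]; ring
    rw [h7]
    refine h6.bdd_mul (c := 1) ?_ (Eventually.of_forall fun p => ?_)
    · refine Continuous.aestronglyMeasurable ?_
      unfold planeWave; fun_prop
    · rw [norm_planeWave]

theorem szego_mem (f : L2) : szego f ∈ hardySpace := hardySpace.starProjection_apply_mem f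

theorem norm_szego_apply_le (f : L2) : ‖szego f‖ ≤ ‖f‖ := hardySpace.norm_starProjection_apply_le f

theorem szego_szego (f : L2) : szego (szego f) = szego f :=
  hardySpace.starProjection_eq_self_iff.2 (szego_mem f)

theorem norm_sub_szego_apply_le (f : L2) : ‖f - szego f‖ ≤ ‖f‖ := by
  have h := hardySpaceᗮ.norm_starProjection_apply_le f
  rwa [hardySpace.starProjection_orthogonal_val] at h

theorem spectrumIn_sub_szego (f : L2) : SpectrumIn (Set.Iio 0) (f - szego f) := by
  refine spectrumIn_of_inner_eq_zero measurableSet_Iio fun g hg => ?_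
  rw [Set.compl_Iio, ← mem_hardySpace_iff] at hg
  exact hardySpace.sub_starProjection_mem_orthogonal f g hg

/-- The operator `b̄ R₀(k) a` on `L²`. -/
def sandwich (b a : L2) (k : CutPlane) : L2 →L[ℂ] L2 :=
  (mulLinfL2 (star b)).comp ((freeResolvent k).comp (mulL2L1 a))

theorem norm_freeResolvent_apply_le (k : CutPlane) (f : L1) : ‖freeResolvent k f‖ ≤ ‖f‖ := by
  have h := (freeResolvent k).le_of_opNorm_le (LinearMap.mkContinuous_norm_le _ zero_le_one _) f
  rwa [one_mul] at h

theorem coeFn_freeResolvent (k : CutPlane) (f : L1) :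
    freeResolvent k f =ᵐ[volume] freeConv k f := (memLp_freeConv k f).coeFn_toLp

theorem coeFn_sandwich (b a : L2) (k : CutPlane) (g : L2) :
    sandwich b a k g =ᵐ[volume] fun x => star (b x) * freeConv k (fun y => a y * g y) x := by
  filter_upwards [coeFn_mulLinfL2 (star b) (freeResolvent k (mulL2L1 a g)), coeFn_star_ae b,
    coeFn_freeResolvent k (mulL2L1 a g)] with x h1 h2 h3
  rw [sandwich, ContinuousLinearMap.comp_apply, ContinuousLinearMap.comp_apply, h1, h2, h3]
  congr 1
  refine integral_congr_ae ?_
  filter_upwards [coeFn_mulL2L1 a g] with y hy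
  rw [hy]

theorem norm_sandwich_apply_le (b a : L2) (k : CutPlane) (g : L2) :
    ‖sandwich b a k g‖ ≤ ‖b‖ * (‖a‖ * ‖g‖) := by
  have h1 := norm_mulLinfL2_apply_le (star b) (freeResolvent k (mulL2L1 a g))
  rw [norm_star_L2] at h1
  refine h1.trans ?_
  gcongr
  exact (norm_freeResolvent_apply_le k _).trans (norm_mulL2L1_apply_le a g)

theorem norm_sandwich_le (b a : L2) (k : CutPlane) : ‖sandwich b a k‖ ≤ ‖b‖ * ‖a‖ :=
  ContinuousLinearMap.opNorm_le_bound _ (by positivity) fun g => by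
    rw [mul_assoc]; exact norm_sandwich_apply_le b a k g

theorem sandwich_sub_left (b b' a : L2) (k : CutPlane) :
    sandwich (b - b') a k = sandwich b a k - sandwich b' a k := by
  simp only [sandwich, mulLinfL2, star_sub_L2, map_sub, ContinuousLinearMap.sub_comp]

theorem sandwich_sub_right (b a a' : L2) (k : CutPlane) :
    sandwich b (a - a') k = sandwich b a k - sandwich b a' k := by
  simp only [sandwich, mulL2L1, map_sub, ContinuousLinearMap.comp_sub]

/-- `C₋ b̄ R₀(k) a C₊`, with `C₋ = 1 - C₊`. -/
def offDiag (b a : L2) (k : CutPlane) : L2 →L[ℂ] L2 :=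
  (1 - szego).comp ((sandwich b a k).comp szego)

theorem norm_szego_le : ‖szego‖ ≤ 1 := hardySpace.starProjection_norm_le

theorem norm_offDiag_le (b a : L2) (k : CutPlane) : ‖offDiag b a k‖ ≤ ‖b‖ * ‖a‖ := by
  refine ContinuousLinearMap.opNorm_le_bound _ (by positivity) fun g => ?_
  refine (norm_sub_szego_apply_le _).trans ((norm_sandwich_apply_le b a k _).trans ?_)
  rw [mul_assoc]
  gcongr
  exact norm_szego_apply_le g

/-- For band-limited `a` and `b`, the pairing of `b̄ R₀(k) a C₊ g` with a function of negative
frequencies is an integral of `G_k` against a correlation whose Fourier transform lives in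
`[-M, M]`: the factor `a C₊ g` has frequencies `≥ -M`, the other one frequencies `≤ M`. -/
theorem exists_norm_offDiag_le_of_bandLimited {M : ℝ} {a b : L2} (ha : BandLimited M a)
    (hb : BandLimited M b) : ∃ C : ℝ, ∀ k : CutPlane, 2 * Real.pi * M < ‖k.toComplex‖ →
      ‖offDiag b a k‖ ≤ C / (‖k.toComplex‖ - 2 * Real.pi * M) := by
  obtain ⟨A, hA0, hA⟩ := ha.ae_bound
  obtain ⟨B, hB0, hB⟩ := hb.ae_bound
  refine ⟨A * B, fun k hk => ?_⟩
  have hd : 0 < ‖k.toComplex‖ - 2 * Real.pi * M := by linarith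
  refine ContinuousLinearMap.opNorm_le_bound _ (by positivity) fun g => ?_
  set F := offDiag b a k g with hF
  have hmul : ∀ (c : L2) (C : ℝ), (∀ᵐ x, ‖c x‖ ≤ C) → 0 ≤ C → ∀ u : L2,
      ∃ w : L2, (w =ᵐ[volume] fun x => c x * u x) ∧ ‖w‖ ≤ C * ‖u‖ := by
    intro c C hc hC u
    have hm : MemLp (fun x => c x * u x) 2 volume :=
      (Lp.memLp u).of_le_mul (c := C) ((Lp.aestronglyMeasurable c).mul (Lp.aestronglyMeasurable u))
        (by filter_upwards [hc] with x hx; rw [norm_mul]; gcongr)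
    refine ⟨hm.toLp _, hm.coeFn_toLp, ?_⟩
    refine Lp.norm_le_mul_norm_of_ae_le_mul ?_
    filter_upwards [hm.coeFn_toLp, hc] with x hx hx2
    rw [hx, norm_mul]; gcongr
  obtain ⟨f₁, hf₁, hf₁n⟩ := hmul a A hA hA0 (szego g)
  obtain ⟨f₂, hf₂, hf₂n⟩ := hmul b B hB hB0 F
  have hs₁ : SpectrumIn (Set.Ici (-M)) f₁ := by
    refine ha.spectrumIn_mul measurableSet_Ici ?_ (mem_hardySpace_iff.1 (szego_mem g)) hf₁
    intro s hs ξ hξ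
    have := abs_le.1 hs
    simp only [Set.mem_Ici] at *
    linarith
  have hs₂ : SpectrumIn (Set.Iic M) f₂ := by
    refine hb.spectrumIn_mul measurableSet_Iic ?_
      (spectrumIn_sub_szego (sandwich b a k (szego g))) hf₂
    intro s hs ξ hξ
    have := abs_le.1 hs
    simp only [Set.mem_Iio, Set.mem_Iic] at *
    linarith
  -- `(1 - C₊) F = F`, so `‖F‖²` is the pairing of `F` with `b̄ R₀(k) a C₊ g`.
  have hFF : inner ℂ F F = inner ℂ F (sandwich b a k (szego g)) := by
    have h1 : F = sandwich b a k (szego g) - szego (sandwich b a k (szego g)) := rfl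
    have h2 : inner ℂ F (szego (sandwich b a k (szego g))) = 0 := by
      rw [h1]; exact hardySpace.starProjection_inner_eq_zero _ _ (szego_mem _)
    conv_lhs => rw [h1, ← h1]
    nth_rewrite 2 [h1]
    rw [inner_sub_right, h2, sub_zero]
  have hi₁ : Integrable f₁ := by
    have : Integrable (mulL2L1 a (szego g)) := L1.integrable_coeFn _
    refine this.congr ?_
    filter_upwards [coeFn_mulL2L1 a (szego g), hf₁] with x h1 h2
    rw [h1, h2]
  have hi₂ : Integrable (fun x => star (f₂ x)) := by
    have : Integrable (mulL2L1 b F) := L1.integrable_coeFn _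
    have h3 : Integrable f₂ := by
      refine this.congr ?_
      filter_upwards [coeFn_mulL2L1 b F, hf₂] with x h1 h2
      rw [h1, h2]
    exact (conjCLE : ℂ →L[ℝ] ℂ).integrable_comp h3
  obtain ⟨hci, hpair⟩ := integral_mul_freeConv k hi₁ hi₂
  have hpair' : inner ℂ F (sandwich b a k (szego g)) =
      ∫ t, kernel k t * ∫ x, star (f₂ x) * f₁ (x - t) := by
    rw [← hpair, L2.inner_def]
    have hconv : freeConv k (fun y => a y * (szego g) y) = freeConv k f₁ := by
      ext x
      refine integral_congr_ae ?_
      filter_upwards [hf₁] with y hy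
      rw [hy]
    refine integral_congr_ae ?_
    filter_upwards [coeFn_sandwich b a k (szego g), hf₂] with x h1 h2
    rw [h1, h2, hconv, RCLike.inner_apply, starRingEnd_apply, star_mul']
    ring
  -- By Plancherel, the correlation of `f₁` and `f₂` is the Fourier transform of `f̂₁ conj(f̂₂)`.
  set ψL : L1 := mulL2L1 (star (𝓕 f₂ : L2)) (𝓕 f₁ : L2) with hψL
  have hψe : ψL =ᵐ[volume] fun ξ => star ((𝓕 f₂ : L2) ξ) * (𝓕 f₁ : L2) ξ := by
    filter_upwards [coeFn_mulL2L1 (star (𝓕 f₂ : L2)) (𝓕 f₁ : L2), coeFn_star_ae (𝓕 f₂ : L2)]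
      with ξ h1 h2
    rw [hψL, h1, h2]
  have hψn : ∫ ξ, ‖ψL ξ‖ ≤ ‖f₂‖ * ‖f₁‖ := by
    rw [← L1.norm_eq_integral_norm]
    refine (norm_mulL2L1_apply_le _ _).trans ?_
    rw [norm_star_L2, Lp.norm_fourier_eq, Lp.norm_fourier_eq]
  have hψM : ∀ᵐ ξ : ℝ, M < |ξ| → ψL ξ = 0 := by
    filter_upwards [hψe, hs₁, hs₂] with ξ h1 h2 h3 hξ
    rw [h1]
    rcases lt_abs.1 hξ with h | h
    · rw [h3 (by simpa using h)]; simp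
    · rw [h2 (by simp only [Set.mem_Ici]; linarith)]; simp
  have hc : ∀ t, ∫ x, star (f₂ x) * f₁ (x - t) =
      ∫ ξ : ℝ, planeWave (-(2 * Real.pi * t)) ξ * ψL ξ := by
    intro t
    have e1 : ∫ x, star (f₂ x) * f₁ (x - t) = inner ℂ f₂ (translate t f₁) := by
      rw [L2.inner_def]
      refine integral_congr_ae ?_
      filter_upwards [coeFn_translate t f₁] with x hx
      rw [hx, RCLike.inner_apply, starRingEnd_apply, mul_comm]
    rw [e1, ← Lp.inner_fourier_eq, fourier_translate, L2.inner_def]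
    refine integral_congr_ae ?_
    filter_upwards [coeFn_modulate (-(2 * Real.pi * t)) (𝓕 f₁ : L2), hψe] with ξ h1 h2
    rw [h1, h2, RCLike.inner_apply, starRingEnd_apply]
    ring
  have hbound := norm_integral_kernel_le k (L1.integrable_coeFn ψL) hψM hk hc hci
  rw [← hpair', ← hFF, inner_self_eq_norm_sq_to_K] at hbound
  have hfin : ‖F‖ * ‖F‖ ≤ (A * B / (‖k.toComplex‖ - 2 * Real.pi * M) * ‖g‖) * ‖F‖ := by
    have h1 : ‖F‖ * ‖F‖ ≤ (∫ ξ, ‖ψL ξ‖) / (‖k.toComplex‖ - 2 * Real.pi * M) := by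
      simpa [sq] using hbound
    refine h1.trans ?_
    have h2 : ∫ ξ, ‖ψL ξ‖ ≤ (B * ‖F‖) * (A * ‖g‖) := by
      refine hψn.trans (mul_le_mul hf₂n (hf₁n.trans ?_) (norm_nonneg _) (by positivity))
      gcongr
      exact norm_szego_apply_le g
    calc _ ≤ (B * ‖F‖) * (A * ‖g‖) / (‖k.toComplex‖ - 2 * Real.pi * M) := by gcongr
      _ = _ := by ring
  rcases eq_or_lt_of_le (norm_nonneg F) with h0 | h0
  · rw [← h0]; positivity
  · exact le_of_mul_le_mul_right hfin h0

/-- The high-energy decoupling of positive and negative frequencies: `C₋ b̄ R₀(k) a C₊ → 0` in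
operator norm, uniformly in the argument of `k`. -/
theorem tendsto_norm_offDiag (b a : L2) :
    Tendsto (fun k => ‖offDiag b a k‖) atInfinity (𝓝 0) := by
  rw [Metric.tendsto_nhds]
  intro ε hε
  set δ : ℝ := ε / (4 * (‖a‖ + ‖b‖ + 1)) with hδ
  have hab : 0 < ‖a‖ + ‖b‖ + 1 := by positivity
  have hδ0 : 0 < δ := by positivity
  obtain ⟨M₁, a', ha1, ha2, -⟩ := exists_bandLimited_near a (lt_min hδ0 one_pos)
  obtain ⟨M₂, b', hb1, hb2, -⟩ := exists_bandLimited_near b (lt_min hδ0 one_pos)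
  have mono : ∀ {M M' : ℝ} {c : L2}, M ≤ M' → BandLimited M c → BandLimited M' c := by
    rintro M M' c h ⟨α, h1, h2, h3⟩
    exact ⟨α, h1, fun s hs => h2 s (h.trans_lt hs), h3⟩
  obtain ⟨C, hC⟩ := exists_norm_offDiag_le_of_bandLimited (mono (le_max_left M₁ M₂) ha2)
    (mono (le_max_right M₁ M₂) hb2)
  set M := max M₁ M₂
  have hinf : Tendsto (fun k : CutPlane => ‖k.toComplex‖) atInfinity atTop := tendsto_comap
  have hlim : Tendsto (fun k : CutPlane => C / (‖k.toComplex‖ - 2 * Real.pi * M)) atInfinity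
      (𝓝 0) := Tendsto.div_atTop tendsto_const_nhds
        (tendsto_atTop_add_const_right _ (-(2 * Real.pi * M)) hinf)
  filter_upwards [hinf.eventually_gt_atTop (2 * Real.pi * M),
    hlim.eventually_lt_const (half_pos hε)] with k hk1 hk2
  rw [Real.dist_eq, sub_zero, abs_of_nonneg (norm_nonneg _)]
  have hdec : offDiag b a k = offDiag (b - b') a k + offDiag b' (a - a') k + offDiag b' a' k := by
    simp only [offDiag, sandwich_sub_left, sandwich_sub_right, ContinuousLinearMap.sub_comp,
      ContinuousLinearMap.comp_sub]
    abel
  have hb'n : ‖b'‖ ≤ ‖b‖ + 1 := by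
    have := norm_sub_norm_le b' b
    rw [norm_sub_rev] at this
    have := hb1.trans_le (min_le_right _ _)
    linarith
  have hb1' := hb1.trans_le (min_le_left _ _)
  have ha1' := ha1.trans_le (min_le_left _ _)
  have e1 : ‖offDiag (b - b') a k‖ ≤ δ * ‖a‖ :=
    (norm_offDiag_le _ _ k).trans (by gcongr)
  have e2 : ‖offDiag b' (a - a') k‖ ≤ (‖b‖ + 1) * δ :=
    (norm_offDiag_le _ _ k).trans (by gcongr)
  have e3 := hC k hk1
  have e4 : δ * ‖a‖ + (‖b‖ + 1) * δ = ε / 4 := by rw [hδ]; field_simp; ring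
  calc ‖offDiag b a k‖ ≤ ‖offDiag (b - b') a k‖ + ‖offDiag b' (a - a') k‖ + ‖offDiag b' a' k‖ := by
        rw [hdec]; exact norm_add₃_le
    _ < ε := by linarith

/-- High-frequency modulation pushes every `L²` function into the Hardy space. -/
theorem tendsto_sub_szego_modulate (f : L2) :
    Tendsto (fun l : ℝ => ‖modulate l f - szego (modulate l f)‖) atTop (𝓝 0) := by
  rw [Metric.tendsto_nhds]
  intro ε hε
  obtain ⟨M, b, hfb, -, hb⟩ := exists_bandLimited_near f hε
  filter_upwards [eventually_ge_atTop (2 * Real.pi * M)] with l hl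
  rw [Real.dist_eq, sub_zero, abs_of_nonneg (norm_nonneg _)]
  have hpi := Real.pi_pos
  have hmem : modulate l b ∈ hardySpace := by
    rw [mem_hardySpace_iff]
    refine hb.modulate fun ξ hξ => ?_
    have : M ≤ l / (2 * Real.pi) := by
      rw [le_div_iff₀ (by positivity)]; linarith
    have := hξ.1
    simp only [Set.mem_Ici]
    linarith
  have h1 : szego (modulate l b) = modulate l b := hardySpace.starProjection_eq_self_iff.2 hmem
  have h2 : modulate l f - szego (modulate l f) =
      modulate l (f - b) - szego (modulate l (f - b)) := by
    rw [map_sub, map_sub, h1]; abel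
  rw [h2]
  refine (norm_sub_szego_apply_le _).trans_lt (lt_of_le_of_lt ?_ hfb)
  refine Lp.norm_le_norm_of_ae_le ?_
  filter_upwards [coeFn_modulate l (f - b)] with x hx
  rw [hx, norm_mul, norm_planeWave, one_mul]

/-! ### The gauge transformation and the inverse of `1 - C₊ q̄ R₀(k) q C₊` -/

section AbsolutelyContinuous

variable {E X : Type*} [NormedAddCommGroup E] [PseudoMetricSpace X]

theorem absolutelyContinuousOnInterval_of_dist_le {F : ℝ → E} {Φ : ℝ → X} {a b : ℝ}
    (h : ∀ x y, dist (F x) (F y) ≤ dist (Φ x) (Φ y)) (hΦ : AbsolutelyContinuousOnInterval Φ a b) :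
    AbsolutelyContinuousOnInterval F a b := by
  unfold AbsolutelyContinuousOnInterval at hΦ ⊢
  exact squeeze_zero (fun _ => Finset.sum_nonneg fun _ _ => dist_nonneg)
    (fun _ => Finset.sum_le_sum fun _ _ => h _ _) hΦ

variable [NormedSpace ℝ E]

theorem absolutelyContinuousOnInterval_of_primitive {f u : ℝ → E} (hf : LocallyIntegrable f)
    (hu : ∀ a b, u b - u a = ∫ x in a..b, f x) (a b : ℝ) :
    AbsolutelyContinuousOnInterval u a b := by
  have hi : ∀ x y, IntervalIntegrable (fun t => ‖f t‖) volume x y := fun x y =>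
    (hf.integrableOn_isCompact isCompact_uIcc).intervalIntegrable.norm
  refine absolutelyContinuousOnInterval_of_dist_le (Φ := fun x => ∫ t in a..x, ‖f t‖)
    (fun x y => ?_) ((hi a b).absolutelyContinuousOnInterval_intervalIntegral (by simp))
  rw [dist_eq_norm, Real.dist_eq, intervalIntegral.integral_interval_sub_left (hi _ _) (hi _ _), hu]
  exact intervalIntegral.norm_integral_le_abs_integral_norm

variable [CompleteSpace E]

theorem ae_hasDerivAt_of_primitive {f u : ℝ → E} (hf : LocallyIntegrable f)
    (hu : ∀ a b, u b - u a = ∫ x in a..b, f x) : ∀ᵐ x, HasDerivAt u (f x) x := by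
  have hue : u = fun x => u 0 + ∫ t in (0 : ℝ)..x, f t := by
    ext x; rw [← hu 0 x, add_sub_cancel]
  filter_upwards [LocallyIntegrable.ae_hasDerivAt_integral hf] with x hx
  rw [hue]
  exact (hx 0).const_add _

/-- The fundamental theorem of calculus for vector-valued absolutely continuous functions. -/
theorem integral_eq_sub_of_ae_hasDerivAt {H h : ℝ → E} {a b : ℝ}
    (hH : AbsolutelyContinuousOnInterval H a b) (hh : LocallyIntegrable h)
    (hd : ∀ᵐ x, HasDerivAt H (h x) x) : H b - H a = ∫ x in a..b, h x := by
  have hi : ∀ x y, IntervalIntegrable h volume x y := fun x y =>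
    (hh.integrableOn_isCompact isCompact_uIcc).intervalIntegrable
  have hp : ∀ x y, (∫ t in a..y, h t) - (∫ t in a..x, h t) = ∫ t in x..y, h t := fun x y =>
    intervalIntegral.integral_interval_sub_left (hi _ _) (hi _ _)
  obtain ⟨C, hC⟩ := (hH.sub (absolutelyContinuousOnInterval_of_primitive hh hp a b)
    ).const_of_ae_hasDerivAt_zero (by
      filter_upwards [hd, ae_hasDerivAt_of_primitive hh hp] with x h1 h2 _
      simpa using h1.sub h2)
  have ha := hC a (by simp)
  have hb := hC b (by simp)
  simp only [Pi.sub_apply, intervalIntegral.integral_same, sub_zero] at ha hb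
  rw [ha, ← hb]
  abel

end AbsolutelyContinuous

theorem continuous_of_primitive {w φ : ℝ → ℝ} (hw : Integrable w)
    (hφ : ∀ a b, φ b - φ a = ∫ x in a..b, w x) : Continuous φ := by
  have hφe : φ = fun x => φ 0 + ∫ t in (0 : ℝ)..x, w t := by
    ext x; rw [← hφ 0 x]; ring
  rw [hφe]
  exact continuous_const.add (intervalIntegral.continuous_primitive
    (fun _ _ => hw.intervalIntegrable) 0)

theorem norm_exp_I_mul (r : ℝ) : ‖exp (I * r)‖ = 1 := by
  rw [norm_exp]; simp

theorem integrable_mul_exp_primitive {w φ : ℝ → ℝ} (hw : Integrable w)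
    (hφ : ∀ a b, φ b - φ a = ∫ x in a..b, w x) :
    Integrable fun x => (w x : ℂ) * exp (I * φ x) := by
  have hc := continuous_of_primitive hw hφ
  refine hw.ofReal.mul_bdd (c := 1) (Continuous.aestronglyMeasurable (by fun_prop))
    (Eventually.of_forall fun x => (norm_exp_I_mul _).le)

theorem exp_primitive_sub {w φ : ℝ → ℝ} (hw : Integrable w)
    (hφ : ∀ a b, φ b - φ a = ∫ x in a..b, w x) (a b : ℝ) :
    exp (I * φ b) - exp (I * φ a) = I * ∫ x in a..b, (w x : ℂ) * exp (I * φ x) := by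
  have hc := continuous_of_primitive hw hφ
  have hwi := hw.locallyIntegrable
  rw [← intervalIntegral.integral_const_mul]
  refine integral_eq_sub_of_ae_hasDerivAt (H := fun x => exp (I * φ x))
    (absolutelyContinuousOnInterval_of_dist_le (fun x y => ?_)
      (absolutelyContinuousOnInterval_of_primitive hwi hφ a b))
    ((integrable_mul_exp_primitive hw hφ).const_mul I).locallyIntegrable ?_
  · have h1 : exp (I * φ x) = exp (I * φ y) * exp (I * ((φ x - φ y : ℝ) : ℂ)) := by
      rw [← exp_add]; congr 1; push_cast; ring
    have h2 : exp (I * φ x) - exp (I * φ y) =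
        exp (I * φ y) * (exp (I * ((φ x - φ y : ℝ) : ℂ)) - 1) := by rw [h1]; ring
    rw [dist_eq_norm, h2, norm_mul, norm_exp_I_mul, one_mul, dist_eq_norm]
    exact Real.norm_exp_I_mul_ofReal_sub_one_le
  · filter_upwards [ae_hasDerivAt_of_primitive hwi hφ] with x hx
    convert! ((hx.ofReal_comp).const_mul I).cexp using 1
    ring

/-- The Volterra structure of the free resolvent: composing two kernels through a weight `v`
gives back the kernel times the integral of `v` between its arguments. -/
theorem integral_kernel_mul_kernel (k : CutPlane) (v : ℝ → ℂ) (x z : ℝ) :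
    ∫ y, kernel k (x - y) * (v y * kernel k (y - z)) =
      kernel k (x - z) * (I * ∫ y in z..x, v y) := by
  unfold kernel
  generalize k.toComplex = c
  have hexp : ∀ y : ℝ, exp (I * c * ((x - y : ℝ) : ℂ)) * exp (I * c * ((y - z : ℝ) : ℂ)) =
      exp (I * c * ((x - z : ℝ) : ℂ)) := by
    intro y
    rw [← exp_add]
    congr 1
    push_cast
    ring
  cases k.side with
  | plus =>
    have h1 : ∀ y, kernelAux .plus c (x - y) * (v y * kernelAux .plus c (y - z)) =
        kernelAux .plus c (x - z) * (I * (Set.Ioo z x).indicator v y) := by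
      intro y
      by_cases h : y ∈ Set.Ioo z x
      · have h2 : z < x := h.1.trans h.2
        simp only [kernelAux, sub_pos, h.1, h.2, h2, if_true, Set.indicator_of_mem h]
        rw [← hexp y]
        ring
      · rw [Set.indicator_of_notMem h]
        simp only [kernelAux, sub_pos]
        split_ifs <;> first | exact absurd ⟨‹z < y›, ‹y < x›⟩ h | simp
    simp_rw [h1]
    rw [integral_const_mul, integral_const_mul, integral_indicator measurableSet_Ioo]
    by_cases h : z < x
    · rw [intervalIntegral.integral_of_le h.le, integral_Ioc_eq_integral_Ioo]
    · simp [kernelAux, h]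
  | minus =>
    have h1 : ∀ y, kernelAux .minus c (x - y) * (v y * kernelAux .minus c (y - z)) =
        kernelAux .minus c (x - z) * (-I * (Set.Ioo x z).indicator v y) := by
      intro y
      by_cases h : y ∈ Set.Ioo x z
      · have h2 : x < z := h.1.trans h.2
        simp only [kernelAux, sub_neg, h.1, h.2, h2, if_true, Set.indicator_of_mem h]
        rw [← hexp y]
        ring
      · rw [Set.indicator_of_notMem h]
        simp only [kernelAux, sub_neg]
        split_ifs <;> first | exact absurd ⟨‹x < y›, ‹y < z›⟩ h | simp
    simp_rw [h1]
    rw [integral_const_mul, integral_const_mul, integral_indicator measurableSet_Ioo]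
    by_cases h : x < z
    · rw [intervalIntegral.integral_of_ge h.le, integral_Ioc_eq_integral_Ioo]; ring
    · simp [kernelAux, h]

/-- The resolvent identity for `-i∂ₓ - w`, whose resolvent is the free one conjugated by the gauge
factor `e^{iφ}`, `φ' = w`. -/
theorem freeConv_gauge (k : CutPlane) {w φ : ℝ → ℝ} (hw : Integrable w)
    (hφ : ∀ a b, φ b - φ a = ∫ x in a..b, w x) {f : ℝ → ℂ} (hf : Integrable f) (x : ℝ) :
    freeConv k (fun y => w y * exp (I * φ y) *
        freeConv k (fun z => exp (-(I * φ z)) * f z) y) x =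
      exp (I * φ x) * freeConv k (fun z => exp (-(I * φ z)) * f z) x - freeConv k f x := by
  have hc := continuous_of_primitive hw hφ
  have hfi : Integrable (fun z => exp (-(I * φ z)) * f z) := by
    refine hf.bdd_mul (c := 1) (Continuous.aestronglyMeasurable (by fun_prop))
      (Eventually.of_forall fun z => ?_)
    rw [exp_neg, norm_inv, norm_exp_I_mul, inv_one]
  have hwi := integrable_mul_exp_primitive hw hφ
  have h1 : ∀ y, kernel k (x - y) * (w y * exp (I * φ y) *
      freeConv k (fun z => exp (-(I * φ z)) * f z) y) =
      ∫ z, kernel k (x - y) * (w y * exp (I * φ y) * kernel k (y - z)) *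
        (exp (-(I * φ z)) * f z) := by
    intro y
    rw [freeConv, ← integral_const_mul, ← integral_const_mul]
    refine integral_congr_ae (Eventually.of_forall fun z => ?_)
    ring
  rw [freeConv]
  simp_rw [h1]
  rw [integral_integral_swap]
  · have h2 : ∀ z, ∫ y, kernel k (x - y) * (w y * exp (I * φ y) * kernel k (y - z)) *
        (exp (-(I * φ z)) * f z) =
        exp (I * φ x) * (kernel k (x - z) * (exp (-(I * φ z)) * f z)) -
          kernel k (x - z) * f z := by
      intro z
      rw [integral_mul_const, integral_kernel_mul_kernel, ← exp_primitive_sub hw hφ]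
      have h3 : exp (I * φ z) * exp (-(I * φ z)) = 1 := by rw [← exp_add]; simp
      linear_combination -(kernel k (x - z) * f z) * h3
    simp_rw [h2]
    rw [integral_sub ((integrable_kernel_mul k hfi x).const_mul _) (integrable_kernel_mul k hf x),
      integral_const_mul]
    rfl
  · have h4 : Integrable (fun p : ℝ × ℝ => (w p.1 * exp (I * φ p.1)) *
        (exp (-(I * φ p.2)) * f p.2)) (volume.prod volume) := hwi.mul_prod hfi
    have h5 : (Function.uncurry fun (y z : ℝ) => kernel k (x - y) *
        (w y * exp (I * φ y) * kernel k (y - z)) * (exp (-(I * φ z)) * f z)) =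
        fun p : ℝ × ℝ => (kernel k (x - p.1) * kernel k (p.1 - p.2)) *
          ((w p.1 * exp (I * φ p.1)) * (exp (-(I * φ p.2)) * f p.2)) := by
      ext p; simp only [Function.uncurry]; ring
    rw [h5]
    refine h4.bdd_mul (c := 1) ?_ (Eventually.of_forall fun p => ?_)
    · exact (((measurable_kernel k).comp (measurable_const.sub measurable_fst)).mul
        ((measurable_kernel k).comp (measurable_fst.sub measurable_snd))).aestronglyMeasurable
    · rw [norm_mul]
      exact mul_le_one₀ (norm_kernel_le k _) (norm_nonneg _) (norm_kernel_le k _)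

theorem integrable_norm_sq (q : L2) : Integrable fun x => ‖q x‖ ^ 2 :=
  (memLp_two_iff_integrable_sq_norm (Lp.aestronglyMeasurable q)).1 (Lp.memLp q)

theorem phase_sub (q : L2) (s : Side) (a b : ℝ) :
    phase q s b - phase q s a = ∫ x in a..b, ‖q x‖ ^ 2 := by
  have hi := integrable_norm_sq q
  cases s with
  | plus => exact intervalIntegral.integral_Iic_sub_Iic hi.integrableOn hi.integrableOn
  | minus =>
    have h := intervalIntegral.integral_Ioi_sub_Ioi' (f := fun x => ‖q x‖ ^ 2) (a := a) (b := b)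
      hi.integrableOn hi.integrableOn
    simp only [phase]
    rw [← h]; ring

theorem continuous_phase (q : L2) (s : Side) : Continuous (phase q s) :=
  continuous_of_primitive (integrable_norm_sq q) (phase_sub q s)

theorem memLp_gauge (q : L2) : MemLp (fun x => exp (-(I * phase q .plus x))) ∞ volume := by
  have hc := continuous_phase q .plus
  refine memLp_top_of_bound (Continuous.aestronglyMeasurable (by fun_prop)) 1
    (Eventually.of_forall fun x => ?_)
  rw [exp_neg, norm_inv, norm_exp_I_mul, inv_one]

/-- The gauge transformed potential `q̃ = e^{-i∫_{-∞}^x |q|²} q`. -/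
def gauged (q : L2) : L2 := mulLinf ((memLp_gauge q).toLp _) q

theorem coeFn_gauged (q : L2) :
    gauged q =ᵐ[volume] fun x => exp (-(I * phase q .plus x)) * q x := by
  filter_upwards [coeFn_mulLinf ((memLp_gauge q).toLp _) q, (memLp_gauge q).coeFn_toLp]
    with x h1 h2
  rw [gauged, h1, h2]

theorem norm_gauged (q : L2) : ‖gauged q‖ = ‖q‖ := by
  rw [Lp.norm_def, Lp.norm_def]
  congr 1
  refine eLpNorm_congr_norm_ae ?_
  filter_upwards [coeFn_gauged q] with x hx
  rw [hx, norm_mul, exp_neg, norm_inv, norm_exp_I_mul, inv_one, one_mul]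

theorem conj_exp_neg_I_mul (r : ℝ) : star (exp (-(I * r))) = exp (I * r) := by
  rw [← starRingEnd_apply, ← exp_conj]; simp

theorem star_mul_self_eq_norm_sq (z : ℂ) : star z * z = ((‖z‖ ^ 2 : ℝ) : ℂ) := by
  rw [← starRingEnd_apply, ← normSq_eq_conj_mul_self, normSq_eq_norm_sq]

theorem integrable_mul_L2 (q g : L2) : Integrable fun x => q x * g x :=
  (L1.integrable_coeFn (mulL2L1 q g)).congr (coeFn_mulL2L1 q g)

theorem freeConv_congr_ae (k : CutPlane) {f g : ℝ → ℂ} (h : f =ᵐ[volume] g) (x : ℝ) :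
    freeConv k f x = freeConv k g x := by
  refine integral_congr_ae ?_
  filter_upwards [h] with y hy
  rw [hy]

/-- `A Ã = Ã - A`; together with `gauged_mul_sandwich` this says that `1 + Ã` inverts `1 - A`. -/
theorem sandwich_mul_gauged (q : L2) (k : CutPlane) :
    sandwich q q k * sandwich (gauged q) (gauged q) k =
      sandwich (gauged q) (gauged q) k - sandwich q q k := by
  refine ContinuousLinearMap.ext fun g => ?_
  set h := sandwich (gauged q) (gauged q) k g with hh
  change sandwich q q k h = h - sandwich q q k g
  have hq := coeFn_gauged q
  have h0 : ∀ x, freeConv k (fun y => gauged q y * g y) x =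
      freeConv k (fun y => exp (-(I * phase q .plus y)) * (q y * g y)) x := fun x => by
    refine freeConv_congr_ae k ?_ x
    filter_upwards [hq] with y hy
    rw [hy]; ring
  have hhe : h =ᵐ[volume] fun x => star (q x) * exp (I * phase q .plus x) *
      freeConv k (fun y => exp (-(I * phase q .plus y)) * (q y * g y)) x := by
    filter_upwards [coeFn_sandwich (gauged q) (gauged q) k g, hq] with x h1 h2
    rw [hh, h1, h0, h2, star_mul', conj_exp_neg_I_mul]
    ring
  apply Lp.ext
  filter_upwards [coeFn_sandwich q q k h, hhe, coeFn_sandwich q q k g,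
    Lp.coeFn_sub h (sandwich q q k g)] with x h1 h2 h3 h4
  rw [h1, h4, Pi.sub_apply, h2, h3]
  have h5 : freeConv k (fun y => q y * h y) x = freeConv k (fun y =>
      ((‖q y‖ ^ 2 : ℝ) : ℂ) * exp (I * phase q .plus y) *
        freeConv k (fun z => exp (-(I * phase q .plus z)) * (q z * g z)) y) x := by
    refine freeConv_congr_ae k ?_ x
    filter_upwards [hhe] with y hy
    rw [hy, ← star_mul_self_eq_norm_sq]; ring
  rw [h5, freeConv_gauge k (integrable_norm_sq q) (phase_sub q .plus) (integrable_mul_L2 q g)]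
  ring

theorem gauged_mul_sandwich (q : L2) (k : CutPlane) :
    sandwich (gauged q) (gauged q) k * sandwich q q k =
      sandwich (gauged q) (gauged q) k - sandwich q q k := by
  refine ContinuousLinearMap.ext fun g => ?_
  set h := sandwich q q k g with hh
  change sandwich (gauged q) (gauged q) k h = sandwich (gauged q) (gauged q) k g - h
  have hq := coeFn_gauged q
  have hE : ∀ y, exp (I * phase q .plus y) * exp (-(I * phase q .plus y)) = 1 := fun y => by
    rw [← exp_add]; simp
  have hhe : h =ᵐ[volume] fun x => star (q x) * freeConv k (fun y => q y * g y) x :=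
    coeFn_sandwich q q k g
  have hfi : Integrable fun y => exp (-(I * phase q .plus y)) * (q y * g y) := by
    have hc := continuous_phase q .plus
    refine (integrable_mul_L2 q g).bdd_mul (c := 1) (Continuous.aestronglyMeasurable (by fun_prop))
      (Eventually.of_forall fun z => ?_)
    rw [exp_neg, norm_inv, norm_exp_I_mul, inv_one]
  have hneg : ∀ a b, -phase q .plus b - -phase q .plus a = ∫ x in a..b, -(‖q x‖ ^ 2) := by
    intro a b
    rw [intervalIntegral.integral_neg, ← phase_sub q .plus]; ring
  apply Lp.ext
  filter_upwards [coeFn_sandwich (gauged q) (gauged q) k h, hhe,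
    coeFn_sandwich (gauged q) (gauged q) k g,
    Lp.coeFn_sub (sandwich (gauged q) (gauged q) k g) h, hq] with x h1 h2 h3 h4 h6
  rw [h1, h4, Pi.sub_apply, h2, h3, h6, star_mul', conj_exp_neg_I_mul]
  have h0 : freeConv k (fun y => gauged q y * g y) x =
      freeConv k (fun y => exp (-(I * phase q .plus y)) * (q y * g y)) x := by
    refine freeConv_congr_ae k ?_ x
    filter_upwards [hq] with y hy
    rw [hy]; ring
  -- the gauge identity for the weight `-|q|²`, applied to `e^{-iφ} q g`
  have h5 := freeConv_gauge k (integrable_norm_sq q).neg hneg hfi x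
  have h7 : ∀ z, exp (-(I * ((-phase q .plus z : ℝ) : ℂ))) *
      (exp (-(I * phase q .plus z)) * (q z * g z)) = q z * g z := by
    intro z
    rw [ofReal_neg, mul_neg, neg_neg, ← mul_assoc, hE, one_mul]
  simp only [h7] at h5
  have h8 : freeConv k (fun y => gauged q y * h y) x = -freeConv k (fun y =>
      ((-(fun x => ‖q x‖ ^ 2)) y : ℝ) * exp (I * ((-phase q .plus y : ℝ) : ℂ)) *
        freeConv k (fun z => q z * g z) y) x := by
    rw [freeConv, freeConv, ← integral_neg]
    refine integral_congr_ae ?_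
    filter_upwards [hhe, hq] with y hy hy2
    rw [hy, hy2, Pi.neg_apply, ofReal_neg, ← star_mul_self_eq_norm_sq, ofReal_neg, mul_neg]
    ring
  rw [h8, h5, h0, ofReal_neg, mul_neg I]
  have halg : ∀ S E E' Z W : ℂ, E * E' = 1 → E * S * -(E' * Z - W) = E * S * W - S * Z :=
    fun S E E' Z W h => by linear_combination -(S * Z) * h
  exact halg _ _ _ _ _ (hE x)

/-- At high energy `1 - C₊ q̄ R₀(k) q C₊` is invertible with a uniformly bounded inverse: up to the
decoupling terms, `1 + C₊ q̃* R₀(k) q̃ C₊` is a two-sided inverse. -/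
theorem eventually_isUnit (q : L2) : ∀ᶠ k in atInfinity,
    IsUnit (1 - birmanSchwinger q k) ∧
      ‖Ring.inverse (1 - birmanSchwinger q k)‖ ≤ 2 * (1 + ‖q‖ * ‖q‖) := by
  have t1 := (tendsto_norm_offDiag q q).const_mul (‖q‖ * ‖q‖)
  have t2 := (tendsto_norm_offDiag (gauged q) (gauged q)).const_mul (‖q‖ * ‖q‖)
  rw [mul_zero] at t1 t2
  have hp : szego * szego = szego := hardySpace.isIdempotentElem_starProjection
  filter_upwards [t1.eventually_lt_const (u := 1 / 2) (by norm_num),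
    t2.eventually_lt_const (u := 1 / 2) (by norm_num)] with k h1 h2
  -- `A B = B A = B - A`, so `x y` and `y x` differ from `1` by terms with a factor `offDiag`.
  set A := sandwich q q k with hA
  set B := sandwich (gauged q) (gauged q) k with hB
  have hBn : ‖B‖ ≤ ‖q‖ * ‖q‖ := by
    have := norm_sandwich_le (gauged q) (gauged q) k
    rwa [norm_gauged] at this
  have hAn : ‖A‖ ≤ ‖q‖ * ‖q‖ := norm_sandwich_le q q k
  have hx : birmanSchwinger q k = szego * A * szego := rfl
  have e1 : offDiag q q k = (1 - szego) * A * szego := rfl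
  have e2 : offDiag (gauged q) (gauged q) k = (1 - szego) * B * szego := rfl
  have hpn := norm_szego_le
  rw [hx]
  rw [e1] at h1
  rw [e2] at h2
  have hAB : A * B = B - A := sandwich_mul_gauged q k
  have hBA : B * A = B - A := gauged_mul_sandwich q k
  clear_value A B
  set p := szego
  set x := 1 - p * A * p
  set y := 1 + p * B * p
  have hyn : ‖y‖ ≤ 1 + ‖q‖ * ‖q‖ := by
    refine (norm_add_le _ _).trans ?_
    gcongr
    · exact ContinuousLinearMap.norm_id_le
    · calc ‖p * B * p‖ ≤ ‖p‖ * ‖B‖ * ‖p‖ :=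
            (norm_mul_le _ _).trans (by gcongr; exact norm_mul_le _ _)
        _ ≤ 1 * (‖q‖ * ‖q‖) * 1 := by gcongr
        _ = _ := by ring
  have hxy : x * y = 1 - -(p * A * ((1 - p) * B * p)) := by
    have : p * A * ((1 - p) * B * p) = p * (A * B) * p - p * A * p * B * p := by noncomm_ring
    have h3 : p * A * p * (p * B * p) = p * A * p * B * p := by
      simp only [← mul_assoc]; rw [mul_assoc (p * A) p p, hp]
    simp only [x, y]
    rw [this, hAB, mul_add, mul_one, sub_mul, one_mul, h3]
    noncomm_ring
  have hyx : y * x = 1 - -(p * B * ((1 - p) * A * p)) := by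
    have : p * B * ((1 - p) * A * p) = p * (B * A) * p - p * B * p * A * p := by noncomm_ring
    have h3 : p * B * p * (p * A * p) = p * B * p * A * p := by
      simp only [← mul_assoc]; rw [mul_assoc (p * B) p p, hp]
    simp only [x, y]
    rw [this, hBA, mul_sub, mul_one, add_mul, one_mul, h3]
    noncomm_ring
  have small : ∀ D F : L2 →L[ℂ] L2, ‖D‖ ≤ ‖q‖ * ‖q‖ → ‖q‖ * ‖q‖ * ‖F‖ < 1 / 2 →
      ‖-(p * D * F)‖ ≤ 1 / 2 := by
    intro D F hD hF
    rw [norm_neg]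
    calc ‖p * D * F‖ ≤ ‖p‖ * ‖D‖ * ‖F‖ :=
          (norm_mul_le _ _).trans (by gcongr; exact norm_mul_le _ _)
      _ ≤ 1 * (‖q‖ * ‖q‖) * ‖F‖ := by gcongr
      _ ≤ 1 / 2 := by rw [one_mul]; exact hF.le
  have s1 := small A _ hAn h2
  have s2 := small B _ hBn h1
  have u1 : IsUnit (x * y) := by
    rw [hxy]; exact isUnit_one_sub_of_norm_lt_one (by linarith)
  have u2 : IsUnit (y * x) := by
    rw [hyx]; exact isUnit_one_sub_of_norm_lt_one (by linarith)
  obtain ⟨v, hv⟩ := u1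
  obtain ⟨v', hv'⟩ := u2
  have hxu : IsUnit x := by
    refine isUnit_iff_exists_and_exists.2 ⟨⟨y * ↑v⁻¹, ?_⟩, ⟨↑v'⁻¹ * y, ?_⟩⟩
    · rw [← mul_assoc, ← hv, v.mul_inv]
    · rw [mul_assoc, ← hv', v'.inv_mul]
  refine ⟨hxu, ?_⟩
  set X := Ring.inverse x
  have h4 : X = y + X * -(p * A * ((1 - p) * B * p)) := by
    have h5 : X * (x * y) = y := by rw [← mul_assoc, Ring.inverse_mul_cancel x hxu, one_mul]
    rw [hxy, mul_sub, mul_one] at h5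
    rw [← h5]; abel
  have h5 : ‖X‖ ≤ (1 + ‖q‖ * ‖q‖) + ‖X‖ * (1 / 2) := by
    calc ‖X‖ = ‖y + X * -(p * A * ((1 - p) * B * p))‖ := congrArg _ h4
      _ ≤ ‖y‖ + ‖X‖ * ‖-(p * A * ((1 - p) * B * p))‖ :=
          (norm_add_le _ _).trans (by gcongr; exact norm_mul_le _ _)
      _ ≤ _ := by gcongr
  linarith

/-! ### The Riemann–Lebesgue lemma for `R₀(k)` and the gauged plane wave -/

theorem norm_freeResolvent_le_of_bound (k : CutPlane) (f : L1) {C : ℝ} (hC : 0 ≤ C)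
    (h : ∀ x, ‖freeConv k f x‖ ≤ C) : ‖freeResolvent k f‖ ≤ C := by
  change ‖(memLp_freeConv k f).toLp _‖ ≤ C
  rw [Lp.norm_toLp]
  refine ENNReal.toReal_le_of_le_ofReal hC ?_
  rw [eLpNorm_exponent_top]
  exact eLpNormEssSup_le_of_ae_bound (Eventually.of_forall h)

/-- `R₀(k)` inverts `-i∂ₓ - k` on test functions. -/
theorem freeConv_deriv (k : CutPlane) {φ : ℝ → ℂ} (hφ : ContDiff ℝ 1 φ)
    (hc : HasCompactSupport φ) (x : ℝ) :
    freeConv k (fun y => -I * deriv φ y - k.toComplex * φ y) x = φ x := by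
  set z := k.toComplex with hz
  set u : ℝ → ℂ := fun y => exp (I * z * ((x - y : ℝ) : ℂ)) * φ y with hu
  have h2 : HasCompactSupport u := hc.mul_left
  have hE : ContDiff ℝ 1 (fun y : ℝ => exp (I * z * ((x - y : ℝ) : ℂ))) := by
    have h : ContDiff ℝ 1 (fun y : ℝ => ((x - y : ℝ) : ℂ)) :=
      ofRealCLM.contDiff.comp (contDiff_const.sub contDiff_id)
    exact (contDiff_const.mul h).cexp
  have h1 : ContDiff ℝ 1 u := hE.mul hφ
  have hd : ∀ y, deriv u y = exp (I * z * ((x - y : ℝ) : ℂ)) * (deriv φ y - I * z * φ y) := by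
    intro y
    have e1 : HasDerivAt (fun y : ℝ => I * z * ((x - y : ℝ) : ℂ)) (I * z * ((-1 : ℝ) : ℂ)) y :=
      (((hasDerivAt_id y).const_sub x).ofReal_comp).const_mul _
    have e2 := (e1.cexp).mul ((hφ.differentiable one_ne_zero) y).hasDerivAt
    rw [show u = (fun y : ℝ => exp (I * z * ((x - y : ℝ) : ℂ))) * φ from rfl, e2.deriv]
    push_cast
    ring
  have key : ∀ y, exp (I * z * ((x - y : ℝ) : ℂ)) * (-I * deriv φ y - z * φ y) =
      -I * deriv u y := by
    intro y
    rw [hd]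
    linear_combination -(exp (I * z * ((x - y : ℝ) : ℂ)) * z * φ y) * I_mul_I
  have hux : u x = φ x := by simp [hu]
  unfold freeConv kernel
  rw [← hz]
  cases k.side with
  | plus =>
    have h3 : ∀ y, kernelAux .plus z (x - y) * (-I * deriv φ y - z * φ y) =
        (Set.Iio x).indicator (fun y => deriv u y) y := by
      intro y
      by_cases h : y < x
      · rw [Set.indicator_of_mem (by exact h)]
        simp only [kernelAux, sub_pos, h, if_true]
        rw [mul_assoc, key]
        linear_combination -(deriv u y) * I_mul_I
      · rw [Set.indicator_of_notMem (by exact h)]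
        simp [kernelAux, h]
    simp_rw [h3]
    rw [integral_indicator measurableSet_Iio, ← integral_Iic_eq_integral_Iio,
      h2.integral_Iic_deriv_eq h1, hux]
  | minus =>
    have h3 : ∀ y, kernelAux .minus z (x - y) * (-I * deriv φ y - z * φ y) =
        (Set.Ioi x).indicator (fun y => -deriv u y) y := by
      intro y
      by_cases h : x < y
      · rw [Set.indicator_of_mem (by exact h)]
        simp only [kernelAux, sub_neg, h, if_true]
        rw [mul_assoc, key]
        linear_combination (deriv u y) * I_mul_I
      · rw [Set.indicator_of_notMem (by exact h)]
        simp [kernelAux, h]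
    simp_rw [h3]
    rw [integral_indicator measurableSet_Ioi, integral_neg, h2.integral_Ioi_deriv_eq h1, hux,
      neg_neg]

/-- The Riemann–Lebesgue lemma for the free resolvent, uniform in the argument of `k`. -/
theorem tendsto_norm_freeResolvent (f : L1) :
    Tendsto (fun k => ‖freeResolvent k f‖) atInfinity (𝓝 0) := by
  have hinf : Tendsto (fun k : CutPlane => ‖k.toComplex‖) atInfinity atTop := tendsto_comap
  rw [Metric.tendsto_nhds]
  intro ε hε
  obtain ⟨u, ⟨g, hug, hg1, hg2⟩, hdist⟩ :=
    (Lp.dense_hasCompactSupport_contDiff (F := ℂ) (μ := (volume : Measure ℝ)) (p := 1)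
      (by norm_num)).exists_dist_lt f (half_pos hε)
  have hg3 : ContDiff ℝ 1 g := hg2.of_le (mod_cast le_top)
  obtain ⟨B, hB⟩ := hg3.continuous.bounded_above_of_compact_support hg1
  have hB0 : 0 ≤ B := (norm_nonneg _).trans (hB 0)
  have hgi : Integrable g := hg3.continuous.integrable_of_hasCompactSupport hg1
  have hdi : Integrable (deriv g) :=
    (hg3.continuous_deriv le_rfl).integrable_of_hasCompactSupport hg1.deriv
  set D := ∫ y, ‖deriv g y‖
  have hD0 : 0 ≤ D := integral_nonneg fun y => norm_nonneg _
  have hlim : Tendsto (fun k : CutPlane => (D + B) / ‖k.toComplex‖) atInfinity (𝓝 0) :=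
    Tendsto.div_atTop tendsto_const_nhds hinf
  filter_upwards [hinf.eventually_gt_atTop 0, hlim.eventually_lt_const (half_pos hε)] with k hk1 hk2
  rw [Real.dist_eq, sub_zero, abs_of_nonneg (norm_nonneg _)]
  have hu : ‖freeResolvent k u‖ ≤ (D + B) / ‖k.toComplex‖ := by
    refine norm_freeResolvent_le_of_bound k u (by positivity) fun x => ?_
    rw [freeConv_congr_ae k hug x, le_div_iff₀ hk1]
    have h1 := freeConv_deriv k hg3 hg1 x
    have h2 : freeConv k (fun y => -I * deriv g y - k.toComplex * g y) x =
        -I * freeConv k (deriv g) x - k.toComplex * freeConv k g x := by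
      simp only [freeConv]
      rw [← integral_const_mul, ← integral_const_mul, ← integral_sub
        ((integrable_kernel_mul k hdi x).const_mul _) ((integrable_kernel_mul k hgi x).const_mul _)]
      refine integral_congr_ae (Eventually.of_forall fun y => ?_)
      ring
    have h3 : ‖freeConv k (deriv g) x‖ ≤ D := by
      refine norm_integral_le_of_norm_le hdi.norm (Eventually.of_forall fun y => ?_)
      rw [norm_mul]
      exact mul_le_of_le_one_left (norm_nonneg _) (norm_kernel_le k _)
    -- `k R₀(k) g = R₀(k)(-i g') - g` gains the factor `1 / |k|`.
    have h4 : freeConv k g x * k.toComplex = -I * freeConv k (deriv g) x - g x := by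
      rw [← h1, h2]; ring
    rw [← norm_mul, h4]
    refine (norm_sub_le _ _).trans ?_
    rw [norm_mul, norm_neg, norm_I, one_mul]
    exact add_le_add h3 (hB x)
  have h5 : freeResolvent k f = freeResolvent k (f - u) + freeResolvent k u := by
    rw [map_sub]; abel
  rw [h5]
  rw [dist_eq_norm] at hdist
  calc _ ≤ ‖freeResolvent k (f - u)‖ + ‖freeResolvent k u‖ := norm_add_le _ _
    _ ≤ ‖f - u‖ + (D + B) / ‖k.toComplex‖ := add_le_add (norm_freeResolvent_apply_le k _) hu
    _ < ε := by linarith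

theorem tendsto_phase_plus_atBot (q : L2) : Tendsto (phase q .plus) atBot (𝓝 0) := by
  have h := intervalIntegral_tendsto_integral_Iic (f := fun x => ‖q x‖ ^ 2) (μ := volume) 0
    (integrable_norm_sq q).integrableOn tendsto_id
  have h2 : Tendsto (fun a => phase q .plus 0 - (phase q .plus 0 - phase q .plus a)) atBot
      (𝓝 (phase q .plus 0 - ∫ x in Set.Iic (0 : ℝ), ‖q x‖ ^ 2)) := by
    simp_rw [phase_sub q .plus]
    exact h.const_sub _
  simp only [sub_sub_cancel] at h2
  rwa [phase, sub_self] at h2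

theorem tendsto_phase_atTop (q : L2) (s : Side) :
    Tendsto (phase q s) atTop (𝓝 (phase q s 0 + ∫ x in Set.Ioi (0 : ℝ), ‖q x‖ ^ 2)) := by
  have h := intervalIntegral_tendsto_integral_Ioi (f := fun x => ‖q x‖ ^ 2) (μ := volume) 0
    (integrable_norm_sq q).integrableOn tendsto_id
  have h2 : Tendsto (fun b => phase q s 0 + (phase q s b - phase q s 0)) atTop
      (𝓝 (phase q s 0 + ∫ x in Set.Ioi (0 : ℝ), ‖q x‖ ^ 2)) := by
    simp_rw [phase_sub q s]
    exact h.const_add _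
  simpa using h2

theorem tendsto_phase_plus_atTop (q : L2) :
    Tendsto (phase q .plus) atTop (𝓝 (∫ x, ‖q x‖ ^ 2)) := by
  have h := tendsto_phase_atTop q .plus
  rwa [phase, ← Set.compl_Iic, integral_add_compl measurableSet_Iic (integrable_norm_sq q)] at h

theorem tendsto_phase_minus_atTop (q : L2) : Tendsto (phase q .minus) atTop (𝓝 0) := by
  simpa [phase] using tendsto_phase_atTop q .minus

theorem tendsto_exp_I_mul {φ : ℝ → ℝ} {l : Filter ℝ} {r : ℝ} (h : Tendsto φ l (𝓝 r)) :
    Tendsto (fun x => exp (I * φ x)) l (𝓝 (exp (I * r))) := by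
  have hc : Continuous fun r : ℝ => exp (I * r) := by fun_prop
  exact (hc.tendsto r).comp h

theorem integrable_gaugeDensity (q : L2) (s : Side) :
    Integrable fun y => ((‖q y‖ ^ 2 : ℝ) : ℂ) * exp (I * phase q s y) :=
  integrable_mul_exp_primitive (integrable_norm_sq q) (phase_sub q s)

theorem integral_Iic_gaugeDensity (q : L2) (x : ℝ) :
    I * ∫ y in Set.Iic x, ((‖q y‖ ^ 2 : ℝ) : ℂ) * exp (I * phase q .plus y) =
      exp (I * phase q .plus x) - 1 := by
  have h1 := (intervalIntegral_tendsto_integral_Iic x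
    (integrable_gaugeDensity q .plus).integrableOn tendsto_id).const_mul I
  have h2 := (tendsto_exp_I_mul (tendsto_phase_plus_atBot q)).const_sub
    (exp (I * phase q .plus x))
  simp_rw [exp_primitive_sub (integrable_norm_sq q) (phase_sub q .plus)] at h2
  simpa using tendsto_nhds_unique h1 h2

theorem integral_Ioi_gaugeDensity (q : L2) (x : ℝ) :
    I * ∫ y in Set.Ioi x, ((‖q y‖ ^ 2 : ℝ) : ℂ) * exp (I * phase q .minus y) =
      1 - exp (I * phase q .minus x) := by
  have h1 := (intervalIntegral_tendsto_integral_Ioi x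
    (integrable_gaugeDensity q .minus).integrableOn tendsto_id).const_mul I
  have h2 := (tendsto_exp_I_mul (tendsto_phase_minus_atTop q)).sub_const
    (exp (I * phase q .minus x))
  simp_rw [exp_primitive_sub (integrable_norm_sq q) (phase_sub q .minus)] at h2
  simpa using tendsto_nhds_unique h1 h2

theorem integral_gaugeDensity (q : L2) :
    I * ∫ y, ((‖q y‖ ^ 2 : ℝ) : ℂ) * exp (I * phase q .plus y) =
      exp (I * ((∫ t : ℝ, ‖q t‖ ^ 2 : ℝ) : ℂ)) - 1 := by
  have h1 := (intervalIntegral_tendsto_integral (integrable_gaugeDensity q .plus)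
    tendsto_neg_atTop_atBot tendsto_id).const_mul I
  have h2 := (tendsto_exp_I_mul (tendsto_phase_plus_atTop q)).sub
    ((tendsto_exp_I_mul (tendsto_phase_plus_atBot q)).comp tendsto_neg_atTop_atBot)
  simp_rw [Function.comp_apply,
    exp_primitive_sub (integrable_norm_sq q) (phase_sub q .plus)] at h2
  simpa using tendsto_nhds_unique h1 h2

theorem boundary_of_pos {l : ℝ} (s : Side) (hl : 0 < l) : boundary s l = .edge s l hl := by
  simp [boundary, hl]

theorem toComplex_boundary (s : Side) (l : ℝ) : (boundary s l).toComplex = l := by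
  unfold boundary
  split_ifs <;> rfl

theorem tendsto_boundary (s : Side) : Tendsto (boundary s) atTop atInfinity := by
  rw [atInfinity, tendsto_comap_iff]
  refine tendsto_atTop_mono (fun l => ?_) tendsto_id
  rw [Function.comp_apply, toComplex_boundary, norm_real]
  exact le_abs_self l

/-- The gauged plane wave `e^{iλx} e^{iφ}` solves the Lippmann–Schwinger equation of the local
operator `-i∂ₓ - |q|²`. -/
theorem freeConv_gaugedWave (q : L2) (s : Side) {l : ℝ} (hl : 0 < l) (x : ℝ) :
    freeConv (boundary s l) (fun y => ((‖q y‖ ^ 2 : ℝ) : ℂ) *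
        (planeWave l y * exp (I * phase q s y))) x =
      planeWave l x * exp (I * phase q s x) - planeWave l x := by
  rw [boundary_of_pos s hl]
  have hexp : ∀ y : ℝ, exp (I * l * ((x - y : ℝ) : ℂ)) * planeWave l y = planeWave l x := by
    intro y
    rw [planeWave, planeWave, ← exp_add]
    congr 1
    push_cast
    ring
  cases s with
  | plus =>
    have h1 : ∀ y, kernel (.edge .plus l hl) (x - y) * (((‖q y‖ ^ 2 : ℝ) : ℂ) *
        (planeWave l y * exp (I * phase q .plus y))) = planeWave l x * (I *
          (Set.Iio x).indicator
            (fun y => ((‖q y‖ ^ 2 : ℝ) : ℂ) * exp (I * phase q .plus y)) y) := by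
      intro y
      by_cases h : y < x
      · rw [Set.indicator_of_mem (by exact h), ← hexp y]
        simp only [kernel, CutPlane.side, CutPlane.toComplex, kernelAux, sub_pos, h, if_true]
        ring
      · rw [Set.indicator_of_notMem (by exact h)]
        simp [kernel, CutPlane.side, kernelAux, h]
    rw [freeConv]
    simp_rw [h1]
    rw [integral_const_mul, integral_const_mul, integral_indicator measurableSet_Iio,
      ← integral_Iic_eq_integral_Iio, integral_Iic_gaugeDensity]
    ring
  | minus =>
    have h1 : ∀ y, kernel (.edge .minus l hl) (x - y) * (((‖q y‖ ^ 2 : ℝ) : ℂ) *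
        (planeWave l y * exp (I * phase q .minus y))) = -planeWave l x * (I *
          (Set.Ioi x).indicator
            (fun y => ((‖q y‖ ^ 2 : ℝ) : ℂ) * exp (I * phase q .minus y)) y) := by
      intro y
      by_cases h : x < y
      · rw [Set.indicator_of_mem (by exact h), ← hexp y]
        simp only [kernel, CutPlane.side, CutPlane.toComplex, kernelAux, sub_neg, h, if_true]
        ring
      · rw [Set.indicator_of_notMem (by exact h)]
        simp [kernel, CutPlane.side, kernelAux, h]
    rw [freeConv]
    simp_rw [h1]
    rw [integral_const_mul, integral_const_mul, integral_indicator measurableSet_Ioi,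
      integral_Ioi_gaugeDensity]
    ring

/-! ### Absence of large eigenvalues -/

/-- An `L²` function is small somewhere on every set of infinite measure. -/
theorem exists_tendsto_zero_of_memLp_two {f : ℝ → ℂ} (hf : MemLp f 2 volume)
    {s : ℕ → Set ℝ} (hvol : ∀ n, volume (s n) = ∞) :
    ∃ a : ℕ → ℝ, (∀ n, a n ∈ s n) ∧ Tendsto (fun n => f (a n)) atTop (𝓝 0) := by
  have h : ∀ n : ℕ, ∃ a ∈ s n, ‖f a‖ < 1 / ((n : ℝ) + 1) := by
    intro n
    by_contra hcon
    push Not at hcon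
    have hpos : (0 : ℝ) < 1 / ((n : ℝ) + 1) := by positivity
    have hi := (memLp_two_iff_integrable_sq_norm hf.1).1 hf
    have h1 := hi.measure_norm_ge_lt_top (ε := (1 / ((n : ℝ) + 1)) ^ 2) (by positivity)
    have h2 : s n ⊆ {x | (1 / ((n : ℝ) + 1)) ^ 2 ≤ ‖‖f x‖ ^ 2‖} := by
      intro x hx
      rw [Set.mem_ofPred_eq, Real.norm_of_nonneg (by positivity)]
      exact pow_le_pow_left₀ hpos.le (hcon x hx) 2
    exact absurd (measure_mono_top h2 (hvol n)) h1.ne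
  choose a ha hfa using h
  exact ⟨a, ha, squeeze_zero_norm (fun n => (hfa n).le) tendsto_one_div_add_atTop_nhds_zero_nat⟩

/-- Duhamel's formula for absolutely continuous solutions of `u' = i (z u + v)`. -/
theorem duhamel {z : ℂ} {u du v : ℝ → ℂ} (hdu : LocallyIntegrable du)
    (hu : ∀ a b, u b - u a = ∫ x in a..b, du x) (hv : LocallyIntegrable v)
    (h : ∀ᵐ x, du x = I * (z * u x + v x)) (a x : ℝ) :
    u x = exp (I * z * ((x - a : ℝ) : ℂ)) * u a +
      ∫ y in a..x, I * exp (I * z * ((x - y : ℝ) : ℂ)) * v y := by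
  have hE : ContDiff ℝ 1 (fun y : ℝ => exp (I * z * ((x - y : ℝ) : ℂ))) := by
    have h : ContDiff ℝ 1 (fun y : ℝ => ((x - y : ℝ) : ℂ)) :=
      ofRealCLM.contDiff.comp (contDiff_const.sub contDiff_id)
    exact (contDiff_const.mul h).cexp
  have hd : ∀ᵐ y, HasDerivAt (fun y : ℝ => exp (I * z * ((x - y : ℝ) : ℂ)) • u y)
      (I * exp (I * z * ((x - y : ℝ) : ℂ)) * v y) y := by
    filter_upwards [ae_hasDerivAt_of_primitive hdu hu, h] with y h1 h2
    have e1 : HasDerivAt (fun y : ℝ => I * z * ((x - y : ℝ) : ℂ)) (I * z * ((-1 : ℝ) : ℂ)) y :=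
      (((hasDerivAt_id y).const_sub x).ofReal_comp).const_mul _
    convert! e1.cexp.mul h1 using 1
    rw [h2]
    push_cast
    ring
  have hl : LocallyIntegrable (fun y : ℝ => I * exp (I * z * ((x - y : ℝ) : ℂ)) * v y) := by
    have := hv.continuous_smul (g := fun y : ℝ => I * exp (I * z * ((x - y : ℝ) : ℂ)))
      (by fun_prop)
    exact this
  have hac : AbsolutelyContinuousOnInterval
      (fun y : ℝ => exp (I * z * ((x - y : ℝ) : ℂ)) • u y) a x :=
    (hE.contDiffOn.absolutelyContinuousOnInterval).fun_smul
      (absolutelyContinuousOnInterval_of_primitive hdu hu a x)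
  have := integral_eq_sub_of_ae_hasDerivAt hac hl hd
  rw [← this]
  simp

/-- A square integrable solution of `-iψ' - v = zψ` is `R₀(k) v`, where `k` is `z` on any side. -/
theorem freeConv_eq_of_ode (k : CutPlane) {u du v : ℝ → ℂ} (hdu : LocallyIntegrable du)
    (hu : ∀ a b, u b - u a = ∫ x in a..b, du x) (hu2 : MemLp u 2 volume) (hv : Integrable v)
    (h : ∀ᵐ x, du x = I * (k.toComplex * u x + v x)) (x : ℝ) : freeConv k v x = u x := by
  have hk := k.side_admits
  have hki := integrable_kernel_mul k hv x
  have hD := duhamel (z := k.toComplex) hdu hu hv.locallyIntegrable h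
  -- Start Duhamel's formula at points `a n → ∓∞` where `u` tends to `0`; on the half line used by
  -- `k` the propagator is bounded by `1`.
  rw [freeConv]
  unfold kernel at hki ⊢
  generalize k.toComplex = z at *
  cases hs : k.side with
  | plus =>
    rw [hs] at hk hki
    have hz : 0 ≤ z.im := hk
    obtain ⟨a, ha, hua⟩ := exists_tendsto_zero_of_memLp_two hu2
      (s := fun n : ℕ => Set.Iic (-(n : ℝ))) (fun n => Real.volume_Iic)
    have hat : Tendsto a atTop atBot :=
      tendsto_atBot_mono ha (tendsto_neg_atTop_atBot.comp tendsto_natCast_atTop_atTop)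
    have h0 : ∀ y, kernelAux .plus z (x - y) * v y = (Set.Iio x).indicator
        (fun y => kernelAux .plus z (x - y) * v y) y := by
      intro y
      by_cases hy : y < x
      · rw [Set.indicator_of_mem (by exact hy)]
      · rw [Set.indicator_of_notMem (by exact hy)]; simp [kernelAux, hy]
    have hlim := intervalIntegral_tendsto_integral_Iic x hki.integrableOn hat
    have hint : ∫ y, kernelAux .plus z (x - y) * v y =
        ∫ y in Set.Iic x, kernelAux .plus z (x - y) * v y := by
      rw [integral_Iic_eq_integral_Iio, ← integral_indicator measurableSet_Iio]
      exact integral_congr_ae (Eventually.of_forall h0)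
    rw [hint]
    refine tendsto_nhds_unique hlim ?_
    have hR : Tendsto (fun n => u x - exp (I * z * ((x - a n : ℝ) : ℂ)) * u (a n)) atTop
        (𝓝 (u x - 0)) := by
      refine tendsto_const_nhds.sub ?_
      refine squeeze_zero_norm' ?_ (tendsto_norm_zero.comp hua)
      filter_upwards [hat.eventually_le_atBot x] with n hn
      rw [norm_mul, Function.comp_apply]
      refine mul_le_of_le_one_left (norm_nonneg _) ?_
      rw [norm_exp, Real.exp_le_one_iff]
      have : 0 ≤ z.im * (x - a n) := mul_nonneg hz (by linarith)
      simpa using this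
    rw [sub_zero] at hR
    refine hR.congr' ?_
    filter_upwards [hat.eventually_le_atBot x] with n hn
    have h1 := hD (a n) x
    have h2 : ∫ y in (a n)..x, kernelAux .plus z (x - y) * v y =
        ∫ y in (a n)..x, I * exp (I * z * ((x - y : ℝ) : ℂ)) * v y := by
      rw [intervalIntegral.integral_of_le hn, intervalIntegral.integral_of_le hn,
        integral_Ioc_eq_integral_Ioo, integral_Ioc_eq_integral_Ioo]
      refine setIntegral_congr_fun measurableSet_Ioo fun y hy => ?_
      simp [kernelAux, hy.2]
    rw [h2]
    linear_combination h1
  | minus =>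
    rw [hs] at hk hki
    have hz : z.im ≤ 0 := hk
    obtain ⟨a, ha, hua⟩ := exists_tendsto_zero_of_memLp_two hu2
      (s := fun n : ℕ => Set.Ici (n : ℝ)) (fun n => Real.volume_Ici)
    have hat : Tendsto a atTop atTop := tendsto_atTop_mono ha tendsto_natCast_atTop_atTop
    have h0 : ∀ y, kernelAux .minus z (x - y) * v y = (Set.Ioi x).indicator
        (fun y => kernelAux .minus z (x - y) * v y) y := by
      intro y
      by_cases hy : x < y
      · rw [Set.indicator_of_mem (by exact hy)]
      · rw [Set.indicator_of_notMem (by exact hy)]; simp [kernelAux, hy]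
    have hlim := intervalIntegral_tendsto_integral_Ioi x hki.integrableOn hat
    have hint : ∫ y, kernelAux .minus z (x - y) * v y =
        ∫ y in Set.Ioi x, kernelAux .minus z (x - y) * v y := by
      rw [← integral_indicator measurableSet_Ioi]
      exact integral_congr_ae (Eventually.of_forall h0)
    rw [hint]
    refine tendsto_nhds_unique hlim ?_
    have hR : Tendsto (fun n => u x - exp (I * z * ((x - a n : ℝ) : ℂ)) * u (a n)) atTop
        (𝓝 (u x - 0)) := by
      refine tendsto_const_nhds.sub ?_
      refine squeeze_zero_norm' ?_ (tendsto_norm_zero.comp hua)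
      filter_upwards [hat.eventually_ge_atTop x] with n hn
      rw [norm_mul, Function.comp_apply]
      refine mul_le_of_le_one_left (norm_nonneg _) ?_
      rw [norm_exp, Real.exp_le_one_iff]
      have : 0 ≤ z.im * (x - a n) := mul_nonneg_of_nonpos_of_nonpos hz (by linarith)
      simpa using this
    rw [sub_zero] at hR
    refine hR.congr' ?_
    filter_upwards [hat.eventually_ge_atTop x] with n hn
    have h1 := hD (a n) x
    have h2 : ∫ y in x..(a n), kernelAux .minus z (x - y) * v y =
        ∫ y in (a n)..x, I * exp (I * z * ((x - y : ℝ) : ℂ)) * v y := by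
      rw [intervalIntegral.integral_of_le hn, intervalIntegral.integral_of_ge hn, ← integral_neg,
        integral_Ioc_eq_integral_Ioo, integral_Ioc_eq_integral_Ioo]
      refine setIntegral_congr_fun measurableSet_Ioo fun y hy => ?_
      simp [kernelAux, hy.1]
    rw [h2]
    linear_combination h1

/-- Eigenvalues of `L_q` produce fixed points of `C₊ q̄ R₀(k) q C₊`. -/
theorem notMem_pointSpectrum (q : L2) (k : CutPlane) (hk : IsUnit (1 - birmanSchwinger q k)) :
    k.toComplex ∉ pointSpectrum q := by
  rintro ⟨ψ, dψ, hψ0, ⟨⟨f, -, hf⟩, u, hψu, hu⟩, heq⟩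
  have hloc : LocallyIntegrable dψ := (Lp.memLp dψ).locallyIntegrable (by norm_num)
  have hu2 : MemLp u 2 volume := (memLp_congr_ae (hf.trans hψu)).1 (Lp.memLp f)
  have hode : ∀ᵐ x, dψ x = I * (k.toComplex * u x + potential q ψ x) := by
    filter_upwards [heq, hψu] with x h1 h2
    rw [← h2, ← h1]
    linear_combination (dψ x) * I_mul_I
  have hfix : freeResolvent k (potential q ψ) = ψ := by
    apply Lp.ext
    filter_upwards [coeFn_freeResolvent k (potential q ψ), hψu] with x h1 h2
    rw [h1, h2]
    exact freeConv_eq_of_ode k hloc hu hu2 (L1.integrable_coeFn _) hode x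
  set g : L2 := szego (mulLinfL2 (star q) ψ) with hg
  have hpot : potential q ψ = mulL2L1 q g := rfl
  have hBS : birmanSchwinger q k g = g := by
    change szego (mulLinfL2 (star q) (freeResolvent k (mulL2L1 q (szego g)))) = g
    rw [hg, szego_szego, ← hg, ← hpot, hfix]
  have hg0 : g = 0 := by
    have h1 : Ring.inverse (1 - birmanSchwinger q k) * (1 - birmanSchwinger q k) = 1 :=
      Ring.inverse_mul_cancel _ hk
    have h2 : (1 - birmanSchwinger q k) g = 0 := by
      rw [sub_apply, hBS, one_apply_eq_self, sub_self]
    have h3 := congrArg (fun T : L2 →L[ℂ] L2 => T g) h1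
    simp only [mul_apply_eq_comp, h2, map_zero, one_apply_eq_self] at h3
    exact h3.symm
  refine hψ0 ?_
  rw [← hfix, hpot, hg0, map_zero, map_zero]

/-! ### High-energy limits of the Jost solutions and scattering coefficients -/

/-- The amplitude `C₊ q̄ m_e(λ ± 0i)`, encoded as `(1 - C₊ q̄ R₀ q C₊)⁻¹ C₊ q̄ e(λ)`. It is
meaningful where the inverse exists, since `Ring.inverse` of a non-unit is `0`. -/
def amplitude (q : L2) (s : Side) (l : ℝ) : L2 :=
  Ring.inverse (1 - birmanSchwinger q (boundary s l))
    (szego (mulLinfL2 (star q) (planeWaveLp l)))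

theorem amplitude_eq {q : L2} {s : Side} {l : ℝ}
    (h : IsUnit (1 - birmanSchwinger q (boundary s l))) :
    amplitude q s l = szego (mulLinfL2 (star q) (planeWaveLp l)) +
      birmanSchwinger q (boundary s l) (amplitude q s l) := by
  have h1 := congrArg (fun T : L2 →L[ℂ] L2 => T (szego (mulLinfL2 (star q) (planeWaveLp l))))
    (Ring.mul_inverse_cancel _ h)
  simp only [mul_apply_eq_comp, one_apply_eq_self, sub_apply] at h1
  change amplitude q s l - birmanSchwinger q (boundary s l) (amplitude q s l) = _ at h1
  rw [← h1, sub_add_cancel]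

theorem szego_amplitude {q : L2} {s : Side} {l : ℝ}
    (h : IsUnit (1 - birmanSchwinger q (boundary s l))) :
    szego (amplitude q s l) = amplitude q s l := by
  have h2 : ∀ g, szego (birmanSchwinger q (boundary s l) g) = birmanSchwinger q (boundary s l) g :=
    fun g => szego_szego _
  rw [amplitude_eq h, map_add, szego_szego, h2]

/-- The resolvent formula for `m_e` collapses, because `X C₊ A C₊ = X - 1` for
`X = (1 - C₊ A C₊)⁻¹`. -/
theorem jostE_eq {q : L2} {s : Side} {l : ℝ}
    (h : IsUnit (1 - birmanSchwinger q (boundary s l))) :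
    jostE q s l = planeWaveLp l +
      freeResolvent (boundary s l) (mulL2L1 q (amplitude q s l)) := by
  set k := boundary s l
  set u := szego (mulLinfL2 (star q) (planeWaveLp l)) with hu
  set X := Ring.inverse (1 - birmanSchwinger q k) with hX
  have h1 : X (birmanSchwinger q k u) = X u - u := by
    have h1 := congrArg (fun T : L2 →L[ℂ] L2 => T u) (Ring.inverse_mul_cancel _ h)
    simp only [mul_apply_eq_comp, one_apply_eq_self, sub_apply, map_sub] at h1
    rw [← hX] at h1
    rw [eq_sub_iff_add_eq', ← eq_sub_iff_add_eq, h1]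
  have huu : szego u = u := szego_szego _
  have h2 : szego (mulLinfL2 (star q) (freeResolvent k (mulL2L1 q u))) =
      birmanSchwinger q k u := by
    conv_lhs => rw [← huu]
    rfl
  change planeWaveLp l + (freeResolvent k (mulL2L1 q u) + freeResolvent k (mulL2L1 q (szego
    (X (szego (mulLinfL2 (star q) (freeResolvent k (mulL2L1 q u)))))))) = _
  rw [h2, h1, map_sub, huu, show X u = amplitude q s l from rfl, szego_amplitude h,
    ← map_add, ← map_add, add_sub_cancel]

theorem potential_jostE {q : L2} {s : Side} {l : ℝ}
    (h : IsUnit (1 - birmanSchwinger q (boundary s l))) :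
    potential q (jostE q s l) = mulL2L1 q (amplitude q s l) := by
  have h1 : szego (mulLinfL2 (star q) (jostE q s l)) = amplitude q s l := by
    rw [jostE_eq h, map_add, map_add]
    conv_rhs => rw [amplitude_eq h]
    congr 1
    conv_lhs => rw [← szego_amplitude h]
    rfl
  rw [← h1]
  rfl

theorem memLp_gaugedWave (q : L2) (s : Side) (l : ℝ) :
    MemLp (fun x => planeWave l x * exp (I * phase q s x)) ∞ volume := by
  have hc := continuous_phase q s
  have hp := continuous_planeWave l
  refine memLp_top_of_bound (Continuous.aestronglyMeasurable (by fun_prop)) 1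
    (Eventually.of_forall fun x => ?_)
  rw [norm_mul, norm_planeWave, norm_exp_I_mul, one_mul]

/-- The gauged plane wave `e^{iλx} e^{iφ_±(x)}`, the asymptotic profile of the Jost solution. -/
def gaugedWave (q : L2) (s : Side) (l : ℝ) : Linf := (memLp_gaugedWave q s l).toLp _

theorem coeFn_gaugedWave (q : L2) (s : Side) (l : ℝ) :
    gaugedWave q s l =ᵐ[volume] fun x => planeWave l x * exp (I * phase q s x) :=
  (memLp_gaugedWave q s l).coeFn_toLp

/-- `q̄` times the gauged plane wave. -/
def gaugedAmplitude (q : L2) (s : Side) (l : ℝ) : L2 := mulLinfL2 (star q) (gaugedWave q s l)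

theorem coeFn_gaugedAmplitude (q : L2) (s : Side) (l : ℝ) :
    gaugedAmplitude q s l =ᵐ[volume] fun x =>
      star (q x) * (planeWave l x * exp (I * phase q s x)) := by
  filter_upwards [coeFn_mulLinfL2 (star q) (gaugedWave q s l), coeFn_star_ae q,
    coeFn_gaugedWave q s l] with x h1 h2 h3
  rw [gaugedAmplitude, h1, h2, h3]

theorem coeFn_mulL2L1_gaugedAmplitude (q : L2) (s : Side) (l : ℝ) :
    mulL2L1 q (gaugedAmplitude q s l) =ᵐ[volume] fun x =>
      ((‖q x‖ ^ 2 : ℝ) : ℂ) * (planeWave l x * exp (I * phase q s x)) := by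
  filter_upwards [coeFn_mulL2L1 q (gaugedAmplitude q s l), coeFn_gaugedAmplitude q s l]
    with x h1 h2
  rw [h1, h2, ← star_mul_self_eq_norm_sq]
  ring

theorem gaugedWave_eq (q : L2) (s : Side) {l : ℝ} (hl : 0 < l) :
    gaugedWave q s l = planeWaveLp l +
      freeResolvent (boundary s l) (mulL2L1 q (gaugedAmplitude q s l)) := by
  apply Lp.ext
  filter_upwards [coeFn_gaugedWave q s l, coeFn_planeWaveLp l, Lp.coeFn_add (planeWaveLp l)
    (freeResolvent (boundary s l) (mulL2L1 q (gaugedAmplitude q s l))),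
    coeFn_freeResolvent (boundary s l) (mulL2L1 q (gaugedAmplitude q s l))] with x h1 h2 h3 h4
  rw [h1, h3, Pi.add_apply, h2, h4,
    freeConv_congr_ae _ (coeFn_mulL2L1_gaugedAmplitude q s l), freeConv_gaugedWave q s hl,
    add_sub_cancel]

/-- The gauged amplitude is a fixed `L²` function modulated by `e(λ)`. -/
theorem tendsto_gaugedAmplitude_sub_szego (q : L2) (s : Side) :
    Tendsto (fun l : ℝ => ‖gaugedAmplitude q s l - szego (gaugedAmplitude q s l)‖) atTop
      (𝓝 0) := by
  refine (tendsto_sub_szego_modulate (gaugedAmplitude q s 0)).congr fun l => ?_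
  have : modulate l (gaugedAmplitude q s 0) = gaugedAmplitude q s l := by
    apply Lp.ext
    filter_upwards [coeFn_modulate l (gaugedAmplitude q s 0), coeFn_gaugedAmplitude q s 0,
      coeFn_gaugedAmplitude q s l] with x h1 h2 h3
    rw [h1, h2, h3]
    simp only [planeWave, ofReal_zero, mul_zero, zero_mul, exp_zero, one_mul]
    ring
  rw [this]

/-- The exact amplitude and the gauged one agree up to the negative frequencies of the latter. -/
theorem tendsto_amplitude_sub_gaugedAmplitude (q : L2) (s : Side) :
    Tendsto (fun l : ℝ => ‖amplitude q s l - gaugedAmplitude q s l‖) atTop (𝓝 0) := by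
  set C := 1 + ‖q‖ * ‖q‖ with hC
  have ht := (tendsto_gaugedAmplitude_sub_szego q s).const_mul (2 * C * C)
  rw [mul_zero] at ht
  refine squeeze_zero' (Eventually.of_forall fun l => norm_nonneg _) ?_ ht
  filter_upwards [(tendsto_boundary s).eventually (eventually_isUnit q),
    eventually_gt_atTop 0] with l hl hl0
  obtain ⟨hu, hX⟩ := hl
  set k := boundary s l
  set h := gaugedAmplitude q s l with hh
  set X := Ring.inverse (1 - birmanSchwinger q k) with hXdef
  set u := szego (mulLinfL2 (star q) (planeWaveLp l)) with hudef
  have e1 : h = mulLinfL2 (star q) (planeWaveLp l) + sandwich q q k h := by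
    conv_lhs => rw [hh, gaugedAmplitude, gaugedWave_eq q s hl0, map_add]
    rfl
  have e2 : szego h = u + szego (sandwich q q k h) := by
    conv_lhs => rw [e1, map_add]
  have e3 : birmanSchwinger q k h = szego (sandwich q q k (szego h)) := rfl
  -- `(1 - C₊ A C₊) h - C₊ q̄ e = (1 + C₊ A) (1 - C₊) h`, as `h = q̄ e + A h`.
  have e4 : h - birmanSchwinger q k h - u =
      (h - szego h) + szego (sandwich q q k (h - szego h)) := by
    rw [e3, map_sub, map_sub, eq_sub_of_add_eq e2.symm]
    abel
  have e5 : h = X (h - birmanSchwinger q k h) := by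
    have h1 := congrArg (fun T : L2 →L[ℂ] L2 => T h) (Ring.inverse_mul_cancel _ hu)
    simp only [mul_apply_eq_comp, one_apply_eq_self, sub_apply] at h1
    exact h1.symm
  have e6 : amplitude q s l - h = -X ((h - szego h) + szego (sandwich q q k (h - szego h))) := by
    rw [← e4, map_sub, ← e5]
    change X u - h = _
    abel
  rw [e6, norm_neg]
  have e7 : ‖(h - szego h) + szego (sandwich q q k (h - szego h))‖ ≤ C * ‖h - szego h‖ := by
    refine (norm_add_le _ _).trans ?_
    have := (norm_szego_apply_le _).trans (norm_sandwich_apply_le q q k (h - szego h))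
    rw [hC, add_mul, one_mul, mul_assoc]
    gcongr
  calc _ ≤ ‖X‖ * ‖(h - szego h) + szego (sandwich q q k (h - szego h))‖ := X.le_opNorm _
    _ ≤ (2 * C) * (C * ‖h - szego h‖) := by gcongr
    _ = _ := by ring

theorem eventually_isUnit_boundary (q : L2) (s : Side) :
    ∀ᶠ l in atTop, IsUnit (1 - birmanSchwinger q (boundary s l)) :=
  ((tendsto_boundary s).eventually (eventually_isUnit q)).mono fun _ h => h.1

theorem tendsto_jostE_sub_gaugedWave (q : L2) (s : Side) :
    Tendsto (fun l : ℝ => ‖jostE q s l - gaugedWave q s l‖) atTop (𝓝 0) := by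
  have ht := (tendsto_amplitude_sub_gaugedAmplitude q s).const_mul ‖q‖
  rw [mul_zero] at ht
  refine squeeze_zero' (Eventually.of_forall fun l => norm_nonneg _) ?_ ht
  filter_upwards [eventually_isUnit_boundary q s, eventually_gt_atTop 0] with l hl hl0
  rw [jostE_eq hl, gaugedWave_eq q s hl0, add_sub_add_left_eq_sub, ← map_sub, ← map_sub]
  exact (norm_freeResolvent_apply_le _ _).trans (norm_mulL2L1_apply_le _ _)

theorem norm_exp_neg_I_mul_mul (l y : ℝ) : ‖exp (-I * l * y)‖ = 1 := by
  rw [norm_exp]; simp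

theorem norm_integral_exp_mul_le (l : ℝ) (f : L1) : ‖∫ y : ℝ, exp (-I * l * y) * f y‖ ≤ ‖f‖ := by
  rw [L1.norm_eq_integral_norm]
  refine norm_integral_le_of_norm_le (L1.integrable_coeFn f).norm (Eventually.of_forall fun y => ?_)
  rw [norm_mul, norm_exp_neg_I_mul_mul, one_mul]

theorem integrable_exp_mul (l : ℝ) (f : L1) : Integrable fun y : ℝ => exp (-I * l * y) * f y :=
  (L1.integrable_coeFn f).bdd_mul (c := 1) (Continuous.aestronglyMeasurable (by fun_prop))
    (Eventually.of_forall fun y => (norm_exp_neg_I_mul_mul l y).le)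

theorem tendsto_scatteringMatrix (q : L2) :
    Tendsto (fun l : ℝ => ‖scatteringMatrix q l -
      exp (I * ((∫ t : ℝ, ‖q t‖ ^ 2 : ℝ) : ℂ))‖) atTop (𝓝 0) := by
  have ht := (tendsto_amplitude_sub_gaugedAmplitude q .plus).const_mul ‖q‖
  rw [mul_zero] at ht
  refine squeeze_zero' (Eventually.of_forall fun l => norm_nonneg _) ?_ ht
  filter_upwards [eventually_isUnit_boundary q .plus] with l hl
  have h1 : exp (I * ((∫ t : ℝ, ‖q t‖ ^ 2 : ℝ) : ℂ)) =
      1 + I * ∫ y : ℝ, exp (-I * l * y) * mulL2L1 q (gaugedAmplitude q .plus l) y := by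
    have h2 : ∫ y : ℝ, exp (-I * l * y) * mulL2L1 q (gaugedAmplitude q .plus l) y =
        ∫ y, ((‖q y‖ ^ 2 : ℝ) : ℂ) * exp (I * phase q .plus y) := by
      refine integral_congr_ae ?_
      filter_upwards [coeFn_mulL2L1_gaugedAmplitude q .plus l] with y hy
      have h3 : exp (-I * l * y) * planeWave l y = 1 := by
        rw [planeWave, ← exp_add, ← exp_zero]; congr 1; ring
      rw [hy]
      linear_combination (((‖q y‖ ^ 2 : ℝ) : ℂ) * exp (I * phase q .plus y)) * h3
    rw [h2, integral_gaugeDensity]; ring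
  have h2 : scatteringMatrix q l - exp (I * ((∫ t : ℝ, ‖q t‖ ^ 2 : ℝ) : ℂ)) =
      I * ∫ y : ℝ, exp (-I * l * y) *
        mulL2L1 q (amplitude q .plus l - gaugedAmplitude q .plus l) y := by
    rw [h1, scatteringMatrix, potential_jostE hl, add_sub_add_left_eq_sub, ← mul_sub,
      ← integral_sub (integrable_exp_mul l _) (integrable_exp_mul l _)]
    congr 1
    refine integral_congr_ae ?_
    rw [map_sub]
    filter_upwards [Lp.coeFn_sub (mulL2L1 q (amplitude q .plus l))
      (mulL2L1 q (gaugedAmplitude q .plus l))] with y hy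
    rw [hy, Pi.sub_apply, mul_sub]
  rw [h2, norm_mul, norm_I, one_mul]
  exact (norm_integral_exp_mul_le l _).trans (norm_mulL2L1_apply_le _ _)

theorem isBounded_exceptionalSet (q : L2) : Bornology.IsBounded (exceptionalSet q) := by
  have hside : ∀ s, ∃ B : ℝ, exceptionalSide q s ⊆ Set.Icc 0 B := by
    intro s
    obtain ⟨B, hB⟩ := eventually_atTop.1 (eventually_isUnit_boundary q s)
    refine ⟨B, fun l hl => ⟨hl.1, ?_⟩⟩
    by_contra hcon
    obtain ⟨g, hg0, hg⟩ := hl.2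
    have h1 := congrArg (fun T : L2 →L[ℂ] L2 => T g)
      (Ring.inverse_mul_cancel _ (hB l (not_le.1 hcon).le))
    simp only [mul_apply_eq_comp, one_apply_eq_self, sub_apply, hg, map_zero] at h1
    exact hg0 h1.symm
  obtain ⟨B₁, h₁⟩ := hside .plus
  obtain ⟨B₂, h₂⟩ := hside .minus
  exact ((Metric.isBounded_Icc 0 B₁).subset h₁).union ((Metric.isBounded_Icc 0 B₂).subset h₂)

theorem eventually_mem_regularSet (q : L2) : ∀ᶠ k in atInfinity, k ∈ regularSet q := by
  obtain ⟨B, hB⟩ := (isBounded_exceptionalSet q).exists_norm_le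
  have hinf : Tendsto (fun k : CutPlane => ‖k.toComplex‖) atInfinity atTop := tendsto_comap
  filter_upwards [eventually_isUnit q, hinf.eventually_gt_atTop B] with k h1 h2
  refine ⟨notMem_pointSpectrum q k h1.1, ?_⟩
  rintro ⟨l, hl, hlk⟩
  have := hB l hl
  rw [← hlk, norm_real] at h2
  linarith

theorem tendsto_norm_jostZero (q : L2) (hq : Integrable q volume) :
    Tendsto (fun k => ‖jostZero q hq k‖) atInfinity (𝓝 0) := by
  set D := 1 + ‖q‖ * (2 * (1 + ‖q‖ * ‖q‖) * ‖q‖) with hD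
  have ht := (tendsto_norm_freeResolvent (hq.toL1 q)).const_mul D
  rw [mul_zero] at ht
  refine squeeze_zero' (Eventually.of_forall fun l => norm_nonneg _) ?_ ht
  filter_upwards [eventually_isUnit q] with k hk
  set r := freeResolvent k (hq.toL1 q)
  set X := Ring.inverse (1 - birmanSchwinger q k)
  change ‖r + freeResolvent k (mulL2L1 q (szego (X (szego (mulLinfL2 (star q) r)))))‖ ≤ D * ‖r‖
  have h1 : ‖szego (mulLinfL2 (star q) r)‖ ≤ ‖q‖ * ‖r‖ := by
    have := (norm_szego_apply_le _).trans (norm_mulLinfL2_apply_le (star q) r)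
    rwa [norm_star_L2] at this
  have h2 : ‖X (szego (mulLinfL2 (star q) r))‖ ≤ 2 * (1 + ‖q‖ * ‖q‖) * (‖q‖ * ‖r‖) :=
    (X.le_opNorm _).trans (mul_le_mul hk.2 h1 (norm_nonneg _) (by positivity))
  calc _ ≤ ‖r‖ + ‖q‖ * (2 * (1 + ‖q‖ * ‖q‖) * (‖q‖ * ‖r‖)) := by
        refine (norm_add_le _ _).trans ?_
        gcongr
        refine (norm_freeResolvent_apply_le _ _).trans ((norm_mulL2L1_apply_le _ _).trans ?_)
        gcongr
        exact (norm_szego_apply_le _).trans h2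
    _ = _ := by rw [hD]; ring

theorem tendsto_integral_mul_exp (f : ℝ → ℂ) :
    Tendsto (fun l : ℝ => ∫ y : ℝ, f y * exp (-I * l * y)) atTop (𝓝 0) := by
  have h := (Real.tendsto_integral_exp_smul_cocompact f).comp
    ((tendsto_id.atTop_div_const (by positivity : (0 : ℝ) < 2 * Real.pi)).mono_right
      atTop_le_cocompact)
  refine h.congr fun l => ?_
  simp only [Function.comp_apply, id_eq]
  refine integral_congr_ae (Eventually.of_forall fun y => ?_)
  simp only [Circle.smul_def, Real.fourierChar_apply, smul_eq_mul]
  rw [mul_comm]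
  congr 2
  have := Real.pi_ne_zero
  push_cast
  field_simp

theorem tendsto_scatteringCoeff (q : L2) (hq : Integrable q volume) :
    Tendsto (fun l : ℝ => scatteringCoeff q hq l) atTop (𝓝 0) := by
  have ht : Tendsto (fun l : ℝ => ‖q‖ * (‖q‖ * ‖jostZero q hq (boundary .plus l)‖)) atTop
      (𝓝 0) := by
    simpa using (((tendsto_norm_jostZero q hq).comp (tendsto_boundary .plus)).const_mul
      ‖q‖).const_mul ‖q‖
  have h1 : Tendsto (fun l : ℝ => ∫ y : ℝ, exp (-I * l * y) *
      mulL2L1 q (szego (mulLinfL2 (star q) (jostZero q hq (boundary .plus l)))) y) atTop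
      (𝓝 0) := by
    refine squeeze_zero_norm (fun l => ?_) ht
    refine (norm_integral_exp_mul_le l _).trans ((norm_mulL2L1_apply_le _ _).trans ?_)
    gcongr
    have := (norm_szego_apply_le _).trans
      (norm_mulLinfL2_apply_le (star q) (jostZero q hq (boundary .plus l)))
    rwa [norm_star_L2] at this
  have h2 := (h1.add (tendsto_integral_mul_exp q)).const_mul I
  rw [add_zero, mul_zero] at h2
  refine h2.congr fun l => ?_
  have hqi : Integrable fun y : ℝ => q y * exp (-I * l * y) :=
    hq.mul_bdd (c := 1) (Continuous.aestronglyMeasurable (by fun_prop))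
      (Eventually.of_forall fun y => (norm_exp_neg_I_mul_mul l y).le)
  rw [scatteringCoeff, ← integral_add (integrable_exp_mul l _) hqi]
  congr 1
  refine integral_congr_ae ?_
  filter_upwards [coeFn_mulL2L1 q
    (szego (mulLinfL2 (star q) (jostZero q hq (boundary .plus l))))] with y hy
  rw [hy]
  ring

end CalogeroMoser

end

theorem mainTheorem6 (q : Lp ℂ 2 (volume : Measure ℝ)) (hq : q ∈ CalogeroMoser.hardySpace) :
    Bornology.IsBounded (CalogeroMoser.exceptionalSet q) ∧
    (∀ s : CalogeroMoser.Side,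
      Tendsto (fun l : ℝ => eLpNorm (fun x : ℝ => CalogeroMoser.jostE q s l x -
          exp (I * l * x) * exp (I * CalogeroMoser.phase q s x)) ∞ volume)
        atTop (𝓝 0)) ∧
    Tendsto (fun l : ℝ => ‖CalogeroMoser.scatteringMatrix q l -
        exp (I * ((∫ t : ℝ, ‖q t‖ ^ 2 : ℝ) : ℂ))‖) atTop (𝓝 0) ∧
    (∀ hq1 : Integrable q volume,
      (∀ᶠ k in CalogeroMoser.atInfinity, k ∈ CalogeroMoser.regularSet q) ∧
      Tendsto (fun k => ‖CalogeroMoser.jostZero q hq1 k‖) CalogeroMoser.atInfinity (𝓝 0) ∧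
      Tendsto (fun l : ℝ => CalogeroMoser.scatteringCoeff q hq1 l) atTop (𝓝 0)) := by
  refine ⟨CalogeroMoser.isBounded_exceptionalSet q, fun s => ?_,
    CalogeroMoser.tendsto_scatteringMatrix q, fun hq1 =>
      ⟨CalogeroMoser.eventually_mem_regularSet q, CalogeroMoser.tendsto_norm_jostZero q hq1,
        CalogeroMoser.tendsto_scatteringCoeff q hq1⟩⟩
  have h := ENNReal.tendsto_ofReal (CalogeroMoser.tendsto_jostE_sub_gaugedWave q s)
  rw [ENNReal.ofReal_zero] at h
  refine h.congr fun l => ?_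
  rw [ofReal_norm, Lp.enorm_def]
  refine eLpNorm_congr_ae ?_
  filter_upwards [Lp.coeFn_sub (CalogeroMoser.jostE q s l) (CalogeroMoser.gaugedWave q s l),
    CalogeroMoser.coeFn_gaugedWave q s l] with x h1 h2
  rw [h1, Pi.sub_apply, h2]
  rfl
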